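/- **Setting.** All systems are finite-dimensional quantum systems. A state is a positive semidefinite matrix of trace one, a Hamiltonian $H$ is a Hermitian matrix, and a state $\rho$ is called symmetric (with respect to $H$) if $\rho=e^{-\mathrm{i}Ht}\rho e^{\mathrm{i}Ht}$ for all $t\in\mathbb R$. The trace distance is $D(\rho,\sigma)=\frac12\|\rho-\sigma\|_1$. A function $f:[0,\infty)\to\mathbb R$, with $f(0)=\lim_{x\to0^+}f(x)$, is *standard monotone* if (i) $0\le A\le B$ implies $f(A)\le f(B)$ for all Hermitian matrices $A,B$ of every size, (ii) $f(x)=xf(1/x)$ for $x>0$, and (iii) $f(1)=1$; it is *regular* if $f(0)\neq0$. For a regular standard monotone $f$ let $c_f(x,y)=\frac{1}{yf(x/y)}$ (extended by $c_f(x,0)=\frac1{xf(0)}$ for $x>0$), and let the metric adjusted skew information be $$I^f(\rho,H)=\frac{f(0)}2\,J^f(\rho_t)\Big|_{t=0},\qquad J^f(\rho_t)=\mathrm{Tr}\big(\partial_t\rho_t\; c_f(L_{\rho_t},R_{\rho_t})(\partial_t\rho_t)\big),\qquad \rho_t=e^{-\mathrm{i}Ht}\rho e^{\mathrm{i}Ht},$$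 where $L_\rho,R_\rho$ are left and right multiplication by $\rho$; equivalently, for $\rho=\sum_i\lambda_i|i\rangle\langle i|$, $I^f(\rho,H)=\frac{f(0)}2\sum_{i,j}(\lambda_i-\lambda_j)^2c_f(\lambda_i,\lambda_j)|\langle i|H|j\rangle|^2$, where terms with $\lambda_i=\lambda_j=0$ are zero. For $\epsilon\in(0,1]$ put $$I^f_\epsilon(\rho,H)=\inf\{I^f(\sigma,H):\ \sigma\text{ a state},\ D(\rho,\sigma)\le\epsilon\}.$$ For sequences $\widehat\rho=\{\rho_m\}_m$ of states of systems with Hamiltonians $\widehat H=\{H_m\}_m$ (the systems may vary arbitrarily with $m$), the rates are the (always existing) limits in $[0,\infty]$ $$I^f_+(\widehat\rho,\widehat H)=\lim_{\epsilon\to0^+}\limsup_{m\to\infty}\tfrac1mI^f_\epsilon(\rho_m,H_m),\qquad I^f_-(\widehat\rho,\widehat H)=\lim_{\epsilon\to0^+}\liminf_{m\to\infty}\tfrac1mI^f_\epsilon(\rho_m,H_m).$$ A covariant operation from a system with Hamiltonian $H$ to one with Hamiltonian $H'$ is a completely positive trace-preserving linear map $\mathcal E$ with $\mathcal E(e^{-\mathrm{i}Ht}\rho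 e^{\mathrm{i}Ht})=e^{-\mathrm{i}H't}\mathcal E(\rho)e^{\mathrm{i}H't}$ for all states $\rho$ and all $t\in\mathbb R$. We write $(\widehat\rho,\widehat H)\succ_{\mathrm a}^{\mathrm{cov}}(\widehat\sigma,\widehat{H'})$ if for every $\epsilon\in(0,1]$ there are covariant operations $\mathcal E_m$ (with respect to $H_m$ and $H'_m$) such that $\limsup_{m\to\infty}D(\mathcal E_m(\rho_m),\sigma_m)\le\epsilon$. **Theorem.** For every regular standard (operator) monotone function $f$, the rates $I^f_+$ and $I^f_-$ are asymptotic asymmetry measures: 1. (Monotonicity) If $(\widehat\rho,\widehat H)\succ_{\mathrm a}^{\mathrm{cov}}(\widehat\sigma,\widehat{H'})$, then $I^f_+(\widehat\rho,\widehat H)\ge I^f_+(\widehat\sigma,\widehat{H'})$ and $I^f_-(\widehat\rho,\widehat H)\ge I^f_-(\widehat\sigma,\widehat{H'})$. 2. If every $\rho_m$ is symmetric with respect to $H_m$, then $I^f_+(\widehat\rho,\widehat H)=I^f_-(\widehat\rho,\widehat H)=0$. -/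

import Mathlib

open Filter Topology Matrix
open scoped ComplexOrder

universe u v

noncomputable section

namespace SmoothSkew

/-! ## Standard monotone functions -/

/-- A standard (operator) monotone function `f : [0, ∞) → ℝ`; the values of `f` on the negative
half-line are never used.  `cfc f A` is the matrix `f(A)` of the functional calculus of a Hermitian
matrix, and `A ≤ B` is the Loewner order, i.e. `B - A` is positive semidefinite.
As usual for operator monotone functions, `f(0)` is the limit of `f(x)` as `x → 0⁺`. -/
structure IsStandardMonotone (f : ℝ → ℝ) : Prop where
  operator_monotone : ∀ (n : ℕ) (A B : Matrix (Fin n) (Fin n) ℂ),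
    A.PosSemidef → (B - A).PosSemidef → (cfc f B - cfc f A).PosSemidef
  symm : ∀ x : ℝ, 0 < x → f x = x * f (1 / x)
  map_one : f 1 = 1
  tendsto_zero : Tendsto f (𝓝[>] 0) (𝓝 (f 0))

/-- A standard monotone function is regular if `f(0) ≠ 0`. -/
def IsRegularAtZero (f : ℝ → ℝ) : Prop := f 0 ≠ 0

/-! ## States, Hamiltonians, time evolution -/

/-- States (density matrices) of a finite-dimensional system with orthonormal basis `d`. -/
structure State (d : Type u) [Fintype d] where
  mat : Matrix d d ℂ
  posSemidef : mat.PosSemidef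
  trace_eq_one : mat.trace = 1

/-- Hamiltonians, i.e. observables (Hermitian matrices). -/
structure Hamiltonian (d : Type u) where
  mat : Matrix d d ℂ
  isHermitian : mat.IsHermitian

section System

variable {d : Type u} [Fintype d] [DecidableEq d]

/-- The unitary `U_t = e^{-iHt}`. -/
def timeUnitary (H : Hamiltonian d) (t : ℝ) : Matrix d d ℂ :=
  NormedSpace.exp ((-(Complex.I * (t : ℂ))) • H.mat)

/-- The time translation `X ↦ e^{-iHt} X e^{iHt}` of matrices. -/
def conjEvolve (H : Hamiltonian d) (t : ℝ) (X : Matrix d d ℂ) : Matrix d d ℂ :=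
  timeUnitary H t * X * (timeUnitary H t)ᴴ

theorem conjTranspose_timeUnitary (H : Hamiltonian d) (t : ℝ) :
    (timeUnitary H t)ᴴ = NormedSpace.exp ((Complex.I * (t : ℂ)) • H.mat) := by
  unfold timeUnitary
  rw [← Matrix.exp_conjTranspose, conjTranspose_smul, H.isHermitian.eq]
  simp

theorem timeUnitary_unitary (H : Hamiltonian d) (t : ℝ) :
    (timeUnitary H t)ᴴ * timeUnitary H t = 1 := by
  have h : NormedSpace.exp ((Complex.I * (t : ℂ)) • H.mat) = (timeUnitary H t)⁻¹ := by
    unfold timeUnitary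
    rw [← Matrix.exp_neg, neg_smul, neg_neg]
  rw [conjTranspose_timeUnitary, h]
  exact Matrix.nonsing_inv_mul _ ((Matrix.isUnit_iff_isUnit_det _).1 (Matrix.isUnit_exp _))

/-- The evolved state `ρ_t = e^{-iHt} ρ e^{iHt}`. -/
def State.evolve (H : Hamiltonian d) (ρ : State d) (t : ℝ) : State d where
  mat := conjEvolve H t ρ.mat
  posSemidef := ρ.posSemidef.mul_mul_conjTranspose_same _
  trace_eq_one := by
    unfold conjEvolve
    rw [Matrix.trace_mul_comm, ← mul_assoc, timeUnitary_unitary, one_mul, ρ.trace_eq_one]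

/-- A state is symmetric if it is invariant under all time translations. -/
def IsSymmetric (ρ : State d) (H : Hamiltonian d) : Prop :=
  ∀ t : ℝ, ρ = ρ.evolve H t

/-- The trace norm `‖X‖₁ = Tr √(X† X)`: the sum of the square roots of the eigenvalues
of `X† X`. -/
def traceNorm (X : Matrix d d ℂ) : ℝ :=
  ∑ i, √((isHermitian_conjTranspose_mul_self X).eigenvalues i)

/-- The trace distance `D(ρ, σ) = ½ ‖ρ - σ‖₁`. -/
def traceDist (X Y : Matrix d d ℂ) : ℝ := (1 / 2) * traceNorm (X - Y)

/-! ## Metric adjusted skew information -/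

/-- The Morozova–Chentsov function `c_f(x, y) = 1 / (y f(x / y))`, extended by its limits
(`c_f(x, 0) = 1 / (x f(0))` for `x > 0`) to pairs with one vanishing entry; at `(0, 0)` the
value of this expression is the irrelevant `0`. -/
def morozovaChentsov (f : ℝ → ℝ) (x y : ℝ) : ℝ :=
  if y = 0 then 1 / (x * f 0) else 1 / (y * f (x / y))

/-- The superoperator `c_f(L_ρ, R_ρ)`.  If `ρ = ∑ i, λ_i |i⟩⟨i|`, the commuting operators `L_ρ`,
`R_ρ` have the joint eigenvectors `|i⟩⟨j|` with eigenvalues `λ_i`, `λ_j`, so that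
`c_f(L_ρ, R_ρ) X = ∑ i j, c_f(λ_i, λ_j) ⟨i|X|j⟩ |i⟩⟨j|`. -/
def mcSuperop (f : ℝ → ℝ) (ρ : State d) (X : Matrix d d ℂ) : Matrix d d ℂ :=
  let hρ := ρ.posSemidef.isHermitian
  let V : Matrix d d ℂ := hρ.eigenvectorUnitary
  V * Matrix.of (fun i j =>
    (morozovaChentsov f (hρ.eigenvalues i) (hρ.eigenvalues j) : ℂ) * (Vᴴ * X * V) i j) * Vᴴ

/-- The derivative `∂_t ρ_t` of a family of states, taken entrywise. -/
def stateDeriv (γ : ℝ → State d) (t : ℝ) : Matrix d d ℂ :=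
  Matrix.of fun i j => deriv (fun s => (γ s).mat i j) t

/-- The quantum Fisher information `J^f(ρ_t) = Tr (∂_t ρ_t · c_f(L_{ρ_t}, R_{ρ_t}) (∂_t ρ_t))` of a
family of states (the trace is real; we take its real part). -/
def quantumFisherInfo (f : ℝ → ℝ) (γ : ℝ → State d) (t : ℝ) : ℝ :=
  (Matrix.trace (stateDeriv γ t * mcSuperop f (γ t) (stateDeriv γ t))).re

/-- The metric adjusted skew information `I^f(ρ, H) = (f(0) / 2) J^f(ρ_t)` at `t = 0`, for
the unitary model `ρ_t = e^{-iHt} ρ e^{iHt}`. -/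
def skewInfo (f : ℝ → ℝ) (ρ : State d) (H : Hamiltonian d) : ℝ :=
  f 0 / 2 * quantumFisherInfo f (fun t => ρ.evolve H t) 0

/-- The `ε`-smooth metric adjusted skew information: the infimum of `I^f(σ, H)` over all states `σ`
with `D(ρ, σ) ≤ ε`, taken in the extended reals. -/
def smoothSkewInfo (f : ℝ → ℝ) (ε : ℝ) (ρ : State d) (H : Hamiltonian d) : EReal :=
  ⨅ (σ : State d) (_ : traceDist ρ.mat σ.mat ≤ ε), (skewInfo f σ H : EReal)

end System

/-! ## Covariant operations -/

section Channel

variable {d : Type u} {d' : Type v} [Fintype d] [DecidableEq d] [Fintype d'] [DecidableEq d']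

/-- A quantum channel: a completely positive trace-preserving linear map.  `Matrix.comp` reads an
`n × n` block matrix with blocks in `Matrix d d ℂ` as a matrix over `Fin n × d`, so the
first field says that `id_n ⊗ E` is positive for all `n`. -/
structure IsChannel (E : Matrix d d ℂ →ₗ[ℂ] Matrix d' d' ℂ) : Prop where
  completely_positive : ∀ (n : ℕ) (M : Matrix (Fin n) (Fin n) (Matrix d d ℂ)),
    (Matrix.comp (Fin n) (Fin n) d d ℂ M).PosSemidef →
      (Matrix.comp (Fin n) (Fin n) d' d' ℂ (M.map E)).PosSemidef
  trace_preserving : ∀ X : Matrix d d ℂ, (E X).trace = X.trace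

/-- A covariant operation: a channel with
`E(e^{-iHt} ρ e^{iHt}) = e^{-iH't} E(ρ) e^{iH't}` for all states `ρ` and all `t`. -/
structure IsCovariantChannel (H : Hamiltonian d) (H' : Hamiltonian d')
    (E : Matrix d d ℂ →ₗ[ℂ] Matrix d' d' ℂ) : Prop where
  isChannel : IsChannel E
  covariant : ∀ (ρ : State d) (t : ℝ),
    E (conjEvolve H t ρ.mat) = conjEvolve H' t (E ρ.mat)

end Channel

/-! ## Sequences of systems -/

section Sequences

variable {d : ℕ → Type u} [∀ m, Fintype (d m)] [∀ m, DecidableEq (d m)]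
  {d' : ℕ → Type v} [∀ m, Fintype (d' m)] [∀ m, DecidableEq (d' m)]

/-- Asymptotic convertibility by covariant operations: for every `ε ∈ (0, 1]` there are covariant
operations `E_m` with `limsup_m D(E_m(ρ_m), σ_m) ≤ ε`. -/
def AsympConvertible (ρ : ∀ m, State (d m)) (H : ∀ m, Hamiltonian (d m))
    (σ : ∀ m, State (d' m)) (H' : ∀ m, Hamiltonian (d' m)) : Prop :=
  ∀ ε : ℝ, 0 < ε → ε ≤ 1 →
    ∃ E : ∀ m, Matrix (d m) (d m) ℂ →ₗ[ℂ] Matrix (d' m) (d' m) ℂ,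
      (∀ m, IsCovariantChannel (H m) (H' m) (E m)) ∧
      limsup (fun m => (traceDist (E m (ρ m).mat) (σ m).mat : EReal)) atTop ≤ (ε : EReal)

/-- `limsup_m (1/m) I_ε^f(ρ_m, H_m)`, in the extended reals. -/
def smoothLimsup (f : ℝ → ℝ) (ρ : ∀ m, State (d m)) (H : ∀ m, Hamiltonian (d m)) (ε : ℝ) :
    EReal :=
  limsup (fun m : ℕ => ((1 / (m : ℝ) : ℝ) : EReal) * smoothSkewInfo f ε (ρ m) (H m)) atTop

/-- `liminf_m (1/m) I_ε^f(ρ_m, H_m)`, in the extended reals. -/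
def smoothLiminf (f : ℝ → ℝ) (ρ : ∀ m, State (d m)) (H : ∀ m, Hamiltonian (d m)) (ε : ℝ) :
    EReal :=
  liminf (fun m : ℕ => ((1 / (m : ℝ) : ℝ) : EReal) * smoothSkewInfo f ε (ρ m) (H m)) atTop

/-- The sup-rate `I_+^f = lim_{ε → 0⁺} limsup_m (1/m) I_ε^f(ρ_m, H_m)`; the limit always
exists in `[-∞, ∞]`, see `tendsto_supRate`. -/
def supRate (f : ℝ → ℝ) (ρ : ∀ m, State (d m)) (H : ∀ m, Hamiltonian (d m)) : EReal :=
  limUnder (𝓝[>] (0 : ℝ)) (smoothLimsup f ρ H)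

/-- The inf-rate `I_-^f = lim_{ε → 0⁺} liminf_m (1/m) I_ε^f(ρ_m, H_m)`; the limit always
exists in `[-∞, ∞]`, see `tendsto_infRate`. -/
def infRate (f : ℝ → ℝ) (ρ : ∀ m, State (d m)) (H : ∀ m, Hamiltonian (d m)) : EReal :=
  limUnder (𝓝[>] (0 : ℝ)) (smoothLiminf f ρ H)

theorem rate_mul_antitone (f : ℝ → ℝ) (ρ : ∀ m, State (d m)) (H : ∀ m, Hamiltonian (d m))
    {ε ε' : ℝ} (h : ε ≤ ε') (m : ℕ) :
    ((1 / (m : ℝ) : ℝ) : EReal) * smoothSkewInfo f ε' (ρ m) (H m) ≤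
      ((1 / (m : ℝ) : ℝ) : EReal) * smoothSkewInfo f ε (ρ m) (H m) := by
  refine mul_le_mul_of_nonneg_left ?_ (by exact_mod_cast (by positivity : (0 : ℝ) ≤ 1 / m))
  exact le_iInf₂ fun σ hσ => iInf₂_le σ (hσ.trans h)

theorem antitone_smoothLimsup (f : ℝ → ℝ) (ρ : ∀ m, State (d m)) (H : ∀ m, Hamiltonian (d m)) :
    Antitone (smoothLimsup f ρ H) := fun _ _ h =>
  limsup_le_limsup (Eventually.of_forall fun m => rate_mul_antitone f ρ H h m)

theorem antitone_smoothLiminf (f : ℝ → ℝ) (ρ : ∀ m, State (d m)) (H : ∀ m, Hamiltonian (d m)) :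
    Antitone (smoothLiminf f ρ H) := fun _ _ h =>
  liminf_le_liminf (Eventually.of_forall fun m => rate_mul_antitone f ρ H h m)

theorem tendsto_supRate (f : ℝ → ℝ) (ρ : ∀ m, State (d m)) (H : ∀ m, Hamiltonian (d m)) :
    Tendsto (smoothLimsup f ρ H) (𝓝[>] 0) (𝓝 (supRate f ρ H)) :=
  tendsto_nhds_limUnder ⟨_, (antitone_smoothLimsup f ρ H).dual_right.tendsto_nhdsGT 0⟩

theorem tendsto_infRate (f : ℝ → ℝ) (ρ : ∀ m, State (d m)) (H : ∀ m, Hamiltonian (d m)) :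
    Tendsto (smoothLiminf f ρ H) (𝓝[>] 0) (𝓝 (infRate f ρ H)) :=
  tendsto_nhds_limUnder ⟨_, (antitone_smoothLiminf f ρ H).dual_right.tendsto_nhdsGT 0⟩

end Sequences

end SmoothSkew

end

/-! Everything rests on one fact: the skew information does not increase under covariant channels.
Granting it, let `E` be covariant with `E ρ` within `ε` of `σ`. Every state `τ` within `δ` of `ρ`
has image within `δ + ε` of `σ`, because channels contract trace distance, and `E τ` has no larger
skew information. Hence `I_{δ+ε}(σ) ≤ I_δ(ρ)`, and letting both radii tend to zero compares the
rates (`smoothSkewInfo_le`). For symmetric states the evolution is constant, so every smoothed value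
is zero.

The monotonicity is Petz's theorem that the metric with kernel `c_f` contracts under channels.
Covariance, differentiated at `t = 0`, makes `E` carry the tangent vector `-i[H, ρ]` to `-i[H', E
ρ]`. For the contraction, `1 / c_f` is the operator mean attached to `f`, evaluated on left and
right multiplication by the state. Operator monotonicity gives a Jensen inequality for contractions,
hence the transformer inequality for this mean (`sum_scalarMean_le`). The Schwarz inequality for the
dual of `E` supplies its two hypotheses, one for left and one for right multiplication. Duality
between the quadratic forms with weights `1 / c_f` and `c_f` turns the result into the contraction
(`IsChannel.metricForm_le`). -/

namespace SmoothSkew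

/-! ### Diagonal quadratic forms and functional calculus. -/

section QuadraticForms

variable {N N' : Type*} [DecidableEq N] [DecidableEq N']

/-- The diagonal complex matrix with given real entries. -/
noncomputable abbrev realDiag (a : N → ℝ) : Matrix N N ℂ := diagonal fun i => (a i : ℂ)

theorem isHermitian_realDiag (a : N → ℝ) : (realDiag a).IsHermitian := by
  rw [Matrix.IsHermitian, diagonal_conjTranspose]
  congr 1
  ext i
  simp

theorem posSemidef_realDiag {a : N → ℝ} (ha : ∀ i, 0 ≤ a i) : (realDiag a).PosSemidef :=
  PosSemidef.diagonal fun i => Complex.zero_le_real.2 (ha i)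

variable [Fintype N] [Fintype N']

theorem dotProduct_realDiag_mulVec (a : N → ℝ) (x : N → ℂ) :
    star x ⬝ᵥ realDiag a *ᵥ x = ((∑ i, a i * ‖x i‖ ^ 2 : ℝ) : ℂ) := by
  simp only [dotProduct, mulVec_diagonal, Pi.star_apply]
  push_cast
  refine Finset.sum_congr rfl fun i _ => ?_
  rw [← Complex.conj_mul', Complex.star_def]
  ring

omit [DecidableEq N'] in
theorem dotProduct_compress_realDiag (a : N → ℝ) (W : Matrix N N' ℂ) (x : N' → ℂ) :
    star x ⬝ᵥ (Wᴴ * realDiag a * W) *ᵥ x = ((∑ i, a i * ‖(W *ᵥ x) i‖ ^ 2 : ℝ) : ℂ) := by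
  rw [← dotProduct_realDiag_mulVec, star_mulVec, ← dotProduct_mulVec, mulVec_mulVec, mulVec_mulVec,
    Matrix.mul_assoc]

theorem posSemidef_sub_compress_iff (a : N → ℝ) (b : N' → ℝ) (W : Matrix N N' ℂ) :
    (realDiag b - Wᴴ * realDiag a * W).PosSemidef ↔
      ∀ x, ∑ i, a i * ‖(W *ᵥ x) i‖ ^ 2 ≤ ∑ j, b j * ‖x j‖ ^ 2 := by
  have key : ∀ x, star x ⬝ᵥ (realDiag b - Wᴴ * realDiag a * W) *ᵥ x =
      ((∑ j, b j * ‖x j‖ ^ 2 - ∑ i, a i * ‖(W *ᵥ x) i‖ ^ 2 : ℝ) : ℂ) := fun x => by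
    rw [sub_mulVec, dotProduct_sub, dotProduct_realDiag_mulVec, dotProduct_compress_realDiag,
      Complex.ofReal_sub]
  rw [posSemidef_iff_dotProduct_mulVec]
  constructor
  · rintro ⟨-, h⟩ x
    have := h x
    rw [key, Complex.zero_le_real] at this
    linarith
  · refine fun h => ⟨(isHermitian_realDiag b).sub
      (isHermitian_conjTranspose_mul_mul _ (isHermitian_realDiag a)), fun x => ?_⟩
    rw [key, Complex.zero_le_real]
    linarith [h x]

theorem eigenvectorUnitary_mul_conjTranspose {M : Matrix N N ℂ} (hM : M.IsHermitian) :
    (hM.eigenvectorUnitary : Matrix N N ℂ) * (hM.eigenvectorUnitary : Matrix N N ℂ)ᴴ = 1 :=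
  Unitary.mul_star_self_of_mem hM.eigenvectorUnitary.2

theorem eigenvectorUnitary_conjTranspose_mul {M : Matrix N N ℂ} (hM : M.IsHermitian) :
    (hM.eigenvectorUnitary : Matrix N N ℂ)ᴴ * (hM.eigenvectorUnitary : Matrix N N ℂ) = 1 :=
  Unitary.star_mul_self_of_mem hM.eigenvectorUnitary.2

theorem eq_eigenvectorUnitary_conj {M : Matrix N N ℂ} (hM : M.IsHermitian) :
    M = (hM.eigenvectorUnitary : Matrix N N ℂ) * realDiag hM.eigenvalues *
      (hM.eigenvectorUnitary : Matrix N N ℂ)ᴴ :=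
  hM.spectral_theorem

theorem conj_eigenvectorUnitary_eq {M : Matrix N N ℂ} (hM : M.IsHermitian) :
    (hM.eigenvectorUnitary : Matrix N N ℂ)ᴴ * M * (hM.eigenvectorUnitary : Matrix N N ℂ) =
      realDiag hM.eigenvalues := by
  have hU' := eigenvectorUnitary_conjTranspose_mul hM
  have hs := congrArg (fun Z => (hM.eigenvectorUnitary : Matrix N N ℂ)ᴴ * Z *
    (hM.eigenvectorUnitary : Matrix N N ℂ)) (eq_eigenvectorUnitary_conj hM)
  refine hs.trans ?_
  simp only [← Matrix.mul_assoc, hU', Matrix.one_mul]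
  rw [Matrix.mul_assoc, hU', Matrix.mul_one]

theorem cfc_eq_eigenvectorUnitary_conj {M : Matrix N N ℂ} (hM : M.IsHermitian) (f : ℝ → ℝ) :
    cfc f M = (hM.eigenvectorUnitary : Matrix N N ℂ) * realDiag (fun i => f (hM.eigenvalues i)) *
      (hM.eigenvectorUnitary : Matrix N N ℂ)ᴴ :=
  hM.cfc_eq f

/-- The functional calculus acts on eigenvectors, collected as columns of `W`. -/
theorem cfc_mul_of_mul_eq {M : Matrix N N ℂ} (hM : M.IsHermitian) (f : ℝ → ℝ)
    {W : Matrix N N' ℂ} {b : N' → ℝ} (h : M * W = W * realDiag b) :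
    cfc f M * W = W * realDiag (fun j => f (b j)) := by
  have hU := eigenvectorUnitary_mul_conjTranspose hM
  have hU' := eigenvectorUnitary_conjTranspose_mul hM
  have hs := eq_eigenvectorUnitary_conj hM
  rw [cfc_eq_eigenvectorUnitary_conj hM]
  set U := (hM.eigenvectorUnitary : Matrix N N ℂ)
  have h1 : realDiag hM.eigenvalues * (Uᴴ * W) = Uᴴ * W * realDiag b := by
    rw [Matrix.mul_assoc Uᴴ, ← h]
    conv_rhs => rw [hs]
    simp only [← Matrix.mul_assoc, hU', Matrix.one_mul]
  -- By `h1`, an entry of `Uᴴ * W` can be nonzero only where the two eigenvalues agree, so applying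
  -- `f` to both preserves the intertwining.
  have h2 : realDiag (fun i => f (hM.eigenvalues i)) * (Uᴴ * W) =
      Uᴴ * W * realDiag (fun j => f (b j)) := by
    ext i j
    have := congrFun (congrFun h1 i) j
    rw [diagonal_mul, mul_diagonal] at this ⊢
    by_cases hc : (Uᴴ * W) i j = 0
    · simp [hc]
    · rw [mul_comm, mul_right_inj' hc] at this
      have h3 : hM.eigenvalues i = b j := by simpa using this
      simp [h3, mul_comm]
  rw [Matrix.mul_assoc, Matrix.mul_assoc, h2, ← Matrix.mul_assoc, ← Matrix.mul_assoc, hU,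
    Matrix.one_mul]

theorem cfc_realDiag (f : ℝ → ℝ) (a : N → ℝ) :
    cfc f (realDiag a) = realDiag (fun i => f (a i)) := by
  simpa using cfc_mul_of_mul_eq (isHermitian_realDiag a) f (W := 1) (b := a) (by simp)

end QuadraticForms

/-! ### Scalar properties of standard monotone functions. -/

namespace IsStandardMonotone

variable {f : ℝ → ℝ} (hf : IsStandardMonotone f)
include hf

theorem monotoneOn : MonotoneOn f (Set.Ici 0) := by
  intro x hx y _ hxy
  have h := hf.operator_monotone 1 (realDiag fun _ => x) (realDiag fun _ => y)
    (posSemidef_realDiag fun _ => hx) (by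
      rw [diagonal_sub]
      exact PosSemidef.diagonal fun i => by
        rw [← Complex.ofReal_sub]; exact Complex.zero_le_real.2 (sub_nonneg.2 hxy))
  rw [cfc_realDiag, cfc_realDiag, diagonal_sub] at h
  have := h.diag_nonneg (i := 0)
  rw [diagonal_apply_eq, ← Complex.ofReal_sub, Complex.zero_le_real] at this
  linarith

theorem pos {x : ℝ} (hx : 0 < x) : 0 < f x := by
  rcases le_total 1 x with h | h
  · have := hf.monotoneOn (Set.mem_Ici.2 zero_le_one) hx.le h
    rw [hf.map_one] at this
    linarith
  · have := hf.monotoneOn (Set.mem_Ici.2 zero_le_one) (Set.mem_Ici.2 (one_div_pos.2 hx).le)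
      ((one_le_div hx).2 h)
    rw [hf.map_one] at this
    rw [hf.symm x hx]
    nlinarith

theorem zero_nonneg : 0 ≤ f 0 :=
  ge_of_tendsto hf.tendsto_zero (eventually_nhdsWithin_of_forall fun _ hx => (hf.pos hx).le)

theorem nonneg {x : ℝ} (hx : 0 ≤ x) : 0 ≤ f x := by
  rcases hx.eq_or_lt with rfl | h
  exacts [hf.zero_nonneg, (hf.pos h).le]

/-- By symmetry `f(x) / x = f(1 / x)`, which is decreasing. This bound yields continuity at positive
points and absorbs the factor `1 + s²` in the Jensen inequality. -/
theorem map_mul_le {x c : ℝ} (hx : 0 ≤ x) (hc : 1 ≤ c) : f (c * x) ≤ c * f x := by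
  rcases hx.eq_or_lt with rfl | h
  · rw [mul_zero]
    nlinarith [hf.zero_nonneg]
  · have hc0 : 0 < c := by linarith
    rw [hf.symm (c * x) (by positivity), hf.symm x h, ← mul_assoc]
    refine mul_le_mul_of_nonneg_left (hf.monotoneOn (Set.mem_Ici.2 (by positivity))
      (Set.mem_Ici.2 (by positivity)) ?_) (by positivity)
    exact one_div_le_one_div_of_le h (by nlinarith)

/-- Monotonicity of `f(y)` and of `y / f(y)` squeezes `f(y)` between `min 1 (y / x) * f x` and `max
1 (y / x) * f x`. -/
theorem tendsto_of_pos {x : ℝ} (hx : 0 < x) : Tendsto f (𝓝 x) (𝓝 (f x)) := by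
  have h1 : Tendsto (fun y => max 1 (y / x) * f x) (𝓝 x) (𝓝 (f x)) := by
    have : Continuous fun y => max 1 (y / x) * f x := by fun_prop
    simpa [hx.ne'] using this.tendsto x
  have h2 : Tendsto (fun y => min 1 (y / x) * f x) (𝓝 x) (𝓝 (f x)) := by
    have : Continuous fun y => min 1 (y / x) * f x := by fun_prop
    simpa [hx.ne'] using this.tendsto x
  have hfx := hf.pos hx
  refine tendsto_of_tendsto_of_tendsto_of_le_of_le' h2 h1 ?_ ?_
  · filter_upwards [lt_mem_nhds hx] with y hy
    rcases le_total x y with h | h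
    · rw [min_eq_left ((one_le_div hx).2 h), one_mul]
      exact hf.monotoneOn hx.le hy.le h
    · have h3 := hf.map_mul_le hy.le ((one_le_div hy).2 h)
      rw [div_mul_cancel₀ _ hy.ne'] at h3
      rw [min_eq_right ((div_le_one hx).2 h)]
      calc y / x * f x ≤ y / x * (x / y * f y) := by gcongr
        _ = f y := by field_simp
  · filter_upwards [lt_mem_nhds hx] with y hy
    rcases le_total x y with h | h
    · have h3 := hf.map_mul_le hx.le ((one_le_div hx).2 h)
      rw [div_mul_cancel₀ _ hx.ne'] at h3
      rwa [max_eq_right ((one_le_div hx).2 h)]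
    · rw [max_eq_left ((div_le_one hx).2 h), one_mul]
      exact hf.monotoneOn hy.le hx.le h

end IsStandardMonotone

open scoped MatrixOrder Matrix.Norms.L2Operator in
theorem exists_eq_conjTranspose_mul_self {N : Type*} [Fintype N] [DecidableEq N]
    {A : Matrix N N ℂ} (hA : A.PosSemidef) : ∃ C : Matrix N N ℂ, A = Cᴴ * C :=
  CStarAlgebra.nonneg_iff_eq_star_mul_self.mp hA.nonneg

/-! ### Jensen's operator inequality from operator monotonicity. -/

section PinchingBound

variable {N N' : Type*} [Fintype N] [DecidableEq N] [Fintype N'] [DecidableEq N']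

/-- A positive semidefinite `A` is dominated by a multiple of its compression to the range of an
isometry `W` plus a large multiple of the complementary projection. -/
theorem posSemidef_pinching_sub {A : Matrix N N ℂ} (hA : A.PosSemidef) {W : Matrix N N' ℂ}
    (hW : Wᴴ * W = 1) {B : Matrix N' N' ℂ} (hB : (B - Wᴴ * A * W).PosSemidef)
    {s l : ℝ} (hs : 0 < s) (hl : ((l : ℂ) • 1 - ((1 + (s⁻¹) ^ 2 : ℝ) : ℂ) • A).PosSemidef) :
    (((1 + s ^ 2 : ℝ) : ℂ) • (W * B * Wᴴ) + (l : ℂ) • (1 - W * Wᴴ) - A).PosSemidef := by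
  set P := W * Wᴴ with hP
  set Q := 1 - P with hQ
  have hPP : P * P = P := by
    rw [hP, Matrix.mul_assoc, ← Matrix.mul_assoc Wᴴ, hW, Matrix.one_mul]
  have hPH : Pᴴ = P := by rw [hP, conjTranspose_mul, conjTranspose_conjTranspose]
  have hQQ : Q * Q = Q := by rw [hQ, sub_mul, mul_sub, mul_sub, hPP]; simp
  have hQH : Qᴴ = Q := by rw [hQ, conjTranspose_sub, hPH, conjTranspose_one]
  have h1 : (((1 + s ^ 2 : ℝ) : ℂ) • (W * (B - Wᴴ * A * W) * Wᴴ)).PosSemidef :=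
    (hB.mul_mul_conjTranspose_same W).smul (Complex.zero_le_real.2 (by positivity))
  have h2 := hl.mul_mul_conjTranspose_same Q
  -- Positivity of this conjugate bounds the cross terms: `PAQ + QAP ≤ s² PAP + s⁻² QAQ`.
  have h3 := hA.mul_mul_conjTranspose_same ((s : ℂ) • P - ((s⁻¹ : ℝ) : ℂ) • Q)
  convert (h1.add h2).add h3 using 1
  have e1 : W * (B - Wᴴ * A * W) * Wᴴ = W * B * Wᴴ - P * A * P := by
    simp only [hP, Matrix.mul_sub, Matrix.sub_mul, Matrix.mul_assoc]
  have e2 : Q * ((l : ℂ) • 1 - ((1 + (s⁻¹) ^ 2 : ℝ) : ℂ) • A) * Qᴴ =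
      (l : ℂ) • Q - ((1 + (s⁻¹) ^ 2 : ℝ) : ℂ) • (Q * A * Q) := by
    rw [hQH, mul_sub Q, sub_mul _ _ Q, mul_smul_comm, mul_one, smul_mul_assoc, hQQ, mul_smul_comm,
      smul_mul_assoc]
  have e3 : ((s : ℂ) • P - ((s⁻¹ : ℝ) : ℂ) • Q)ᴴ = (s : ℂ) • P - ((s⁻¹ : ℝ) : ℂ) • Q := by
    rw [conjTranspose_sub, conjTranspose_smul, conjTranspose_smul, hPH, hQH]
    simp
  have e4 : A = P * A * P + P * A * Q + Q * A * P + Q * A * Q := by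
    rw [hQ]; noncomm_ring
  have hs' : (s : ℂ) * (s : ℂ)⁻¹ = 1 := mul_inv_cancel₀ (by exact_mod_cast hs.ne')
  rw [e1, e2, e3]
  conv_lhs => rw [e4]
  simp only [sub_mul, mul_sub, smul_mul_assoc, mul_smul_comm, smul_smul, smul_sub]
  push_cast
  rw [hs', mul_comm (s : ℂ)⁻¹, hs']
  module

end PinchingBound

namespace IsStandardMonotone

variable {f : ℝ → ℝ} (hf : IsStandardMonotone f)
include hf

/-- The pinching bound gives a matrix `M ≥ A` which acts as `(1 + s²) b` on the range of `W`. Hence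
`f(A) ≤ f(M)`, and compressing by `W` gives the claim up to the factor `1 + s²`, which disappears as
`s → 0`. -/
theorem sum_map_le_of_isometry_fin {n : ℕ} {N' : Type*} [Fintype N'] [DecidableEq N']
    {W : Matrix (Fin n) N' ℂ} (hW : Wᴴ * W = 1) {a : Fin n → ℝ} {b : N' → ℝ}
    (ha : ∀ i, 0 ≤ a i) (hb : ∀ j, 0 ≤ b j)
    (h : ∀ x, ∑ i, a i * ‖(W *ᵥ x) i‖ ^ 2 ≤ ∑ j, b j * ‖x j‖ ^ 2) (x : N' → ℂ) :
    ∑ i, f (a i) * ‖(W *ᵥ x) i‖ ^ 2 ≤ ∑ j, f (b j) * ‖x j‖ ^ 2 := by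
  have key : ∀ s : ℝ, 0 < s →
      ∑ i, f (a i) * ‖(W *ᵥ x) i‖ ^ 2 ≤ (1 + s ^ 2) * ∑ j, f (b j) * ‖x j‖ ^ 2 := by
    intro s hs
    -- The trace of `realDiag a` dominates each of its entries, so this `l` is large enough for the
    -- pinching bound.
    set l : ℝ := (1 + s⁻¹ ^ 2) * ∑ i, a i with hl
    have hl' : ((l : ℂ) • 1 - ((1 + s⁻¹ ^ 2 : ℝ) : ℂ) • realDiag a).PosSemidef := by
      rw [smul_one_eq_diagonal, ← diagonal_smul, diagonal_sub]
      refine PosSemidef.diagonal fun i => ?_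
      simp only [Pi.smul_apply, smul_eq_mul]
      rw [← Complex.ofReal_mul, ← Complex.ofReal_sub]
      refine Complex.zero_le_real.2 (sub_nonneg.2 ?_)
      exact mul_le_mul_of_nonneg_left
        (Finset.single_le_sum (fun i _ => ha i) (Finset.mem_univ i)) (by positivity)
    have hM := posSemidef_pinching_sub (posSemidef_realDiag ha) hW
      ((posSemidef_sub_compress_iff a b W).2 h) hs hl'
    set M := ((1 + s ^ 2 : ℝ) : ℂ) • (W * realDiag b * Wᴴ) + (l : ℂ) • (1 - W * Wᴴ)
    have hMH : M.IsHermitian := by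
      simpa using hM.isHermitian.add (isHermitian_realDiag a)
    have hMW : M * W = W * realDiag (fun j => (1 + s ^ 2) * b j) := by
      have e : realDiag (fun j => (1 + s ^ 2) * b j) = ((1 + s ^ 2 : ℝ) : ℂ) • realDiag b := by
        ext i j
        by_cases hij : i = j <;> simp [hij]
      simp only [M, Matrix.add_mul, Matrix.smul_mul, Matrix.sub_mul, Matrix.mul_assoc, hW, e,
        Matrix.mul_smul]
      simp
    have h4 := (hf.operator_monotone n _ _ (posSemidef_realDiag ha) hM).conjTranspose_mul_mul_same W
    rw [Matrix.mul_sub, Matrix.sub_mul, Matrix.mul_assoc, cfc_mul_of_mul_eq hMH f hMW,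
      ← Matrix.mul_assoc, hW, Matrix.one_mul, cfc_realDiag, posSemidef_sub_compress_iff] at h4
    refine (h4 x).trans ?_
    rw [Finset.mul_sum]
    refine Finset.sum_le_sum fun j _ => ?_
    rw [← mul_assoc]
    exact mul_le_mul_of_nonneg_right (hf.map_mul_le (hb j) (by nlinarith)) (by positivity)
  have hlim : Tendsto (fun s : ℝ => (1 + s ^ 2) * ∑ j, f (b j) * ‖x j‖ ^ 2) (𝓝[>] 0)
      (𝓝 (∑ j, f (b j) * ‖x j‖ ^ 2)) := by
    have : Continuous fun s : ℝ => (1 + s ^ 2) * ∑ j, f (b j) * ‖x j‖ ^ 2 := by fun_prop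
    simpa using (this.tendsto 0).mono_left nhdsWithin_le_nhds
  exact ge_of_tendsto hlim (eventually_nhdsWithin_of_forall key)

variable {N N' : Type*} [Fintype N] [DecidableEq N] [Fintype N'] [DecidableEq N']

-- Operator monotonicity is available for matrices indexed by `Fin n`; reindexing the rows of `W`
-- removes this restriction.
omit [DecidableEq N] in
theorem sum_map_le_of_isometry
    {W : Matrix N N' ℂ} (hW : Wᴴ * W = 1) {a : N → ℝ} {b : N' → ℝ}
    (ha : ∀ i, 0 ≤ a i) (hb : ∀ j, 0 ≤ b j)
    (h : ∀ x, ∑ i, a i * ‖(W *ᵥ x) i‖ ^ 2 ≤ ∑ j, b j * ‖x j‖ ^ 2) (x : N' → ℂ) :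
    ∑ i, f (a i) * ‖(W *ᵥ x) i‖ ^ 2 ≤ ∑ j, f (b j) * ‖x j‖ ^ 2 := by
  let e := (Fintype.equivFin N).symm
  have hmv : ∀ x i, ((W.submatrix e id) *ᵥ x) i = (W *ᵥ x) (e i) := fun _ _ => rfl
  have h2 : (W.submatrix e id)ᴴ * W.submatrix e id = 1 := by
    rw [conjTranspose_submatrix, submatrix_mul_equiv, hW, submatrix_one _ Function.injective_id]
  have := hf.sum_map_le_of_isometry_fin h2 (a := a ∘ e) (b := b) (fun i => ha _) hb
    (fun x => by
      simp only [hmv, Function.comp]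
      rw [e.sum_comp fun i => a i * ‖(W *ᵥ x) i‖ ^ 2]
      exact h x) x
  simp only [hmv, Function.comp] at this
  rwa [e.sum_comp fun i => f (a i) * ‖(W *ᵥ x) i‖ ^ 2] at this

/-- A form of Jensen's operator inequality for contractions `V` and diagonal matrices. -/
theorem sum_map_le_of_contraction
    {V : Matrix N N' ℂ} (hV : ∀ x, ∑ i, ‖(V *ᵥ x) i‖ ^ 2 ≤ ∑ j, ‖x j‖ ^ 2)
    {a : N → ℝ} {b : N' → ℝ} (ha : ∀ i, 0 ≤ a i) (hb : ∀ j, 0 ≤ b j)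
    (h : ∀ x, ∑ i, a i * ‖(V *ᵥ x) i‖ ^ 2 ≤ ∑ j, b j * ‖x j‖ ^ 2) (x : N' → ℂ) :
    ∑ i, f (a i) * ‖(V *ᵥ x) i‖ ^ 2 ≤ ∑ j, f (b j) * ‖x j‖ ^ 2 := by
  have h1 : (1 - Vᴴ * V).PosSemidef := by
    have := (posSemidef_sub_compress_iff (fun _ => 1) (fun _ => 1) V).2 (by simpa using hV)
    have e : (realDiag fun _ : N => 1) = 1 := by simp; rfl
    have e' : (realDiag fun _ : N' => 1) = 1 := by simp; rfl
    rwa [e, e', Matrix.mul_one] at this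
  -- Stacking `C` with `Cᴴ * C = 1 - Vᴴ * V` under `V` dilates it to an isometry. The new rows get
  -- weight `0`; their contribution after applying `f` is nonnegative because `f 0 ≥ 0`, and is
  -- dropped.
  obtain ⟨C, hC⟩ := exists_eq_conjTranspose_mul_self h1
  have hW : (fromRows V C)ᴴ * fromRows V C = 1 := by
    rw [conjTranspose_fromRows_eq_fromCols_conjTranspose, fromCols_mul_fromRows, ← hC]
    abel
  have := hf.sum_map_le_of_isometry hW (a := Sum.elim a 0) (b := b)
    (by rintro (i | i) <;> simp [ha]) hb (fun x => by simpa [fromRows_mulVec] using h x) x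
  simp only [fromRows_mulVec, Fintype.sum_sum_type, Sum.elim_inl, Sum.elim_inr] at this
  refine le_trans (le_add_of_nonneg_right ?_) this
  exact Finset.sum_nonneg fun j _ => mul_nonneg hf.zero_nonneg (by positivity)

end IsStandardMonotone

/-! ### Operator means and the transformer inequality. -/

theorem sum_norm_mulVec_sq_le {N N' : Type*} [Fintype N] [Fintype N']
    (T : Matrix N N' ℂ) (x : N' → ℂ) :
    ∑ i, ‖(T *ᵥ x) i‖ ^ 2 ≤ (∑ i, ∑ j, ‖T i j‖ ^ 2) * ∑ j, ‖x j‖ ^ 2 := by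
  rw [Finset.sum_mul]
  refine Finset.sum_le_sum fun i _ => ?_
  calc ‖(T *ᵥ x) i‖ ^ 2 ≤ (∑ j, ‖T i j‖ * ‖x j‖) ^ 2 := by
        gcongr
        simpa [mulVec, dotProduct] using norm_sum_le Finset.univ fun j => T i j * x j
    _ ≤ _ := Finset.sum_mul_sq_le_sq_mul_sq _ _ _

/-- The operator mean `y f(x / y)` of two nonnegative numbers, the reciprocal of the
Morozova–Chentsov function. -/
noncomputable def scalarMean (f : ℝ → ℝ) (x y : ℝ) : ℝ :=
  if y = 0 then x * f 0 else y * f (x / y)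

theorem morozovaChentsov_eq_inv (f : ℝ → ℝ) (x y : ℝ) :
    morozovaChentsov f x y = (scalarMean f x y)⁻¹ := by
  unfold morozovaChentsov scalarMean
  split_ifs <;> rw [one_div]

namespace IsStandardMonotone

variable {f : ℝ → ℝ} (hf : IsStandardMonotone f)
include hf

theorem scalarMean_nonneg {x y : ℝ} (hx : 0 ≤ x) (hy : 0 ≤ y) : 0 ≤ scalarMean f x y := by
  unfold scalarMean
  split_ifs
  · exact mul_nonneg hx hf.zero_nonneg
  · exact mul_nonneg hy (hf.nonneg (by positivity))

theorem eq_zero_of_scalarMean_eq_zero (hreg : f 0 ≠ 0) {x y : ℝ} (hx : 0 ≤ x) (hy : 0 ≤ y)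
    (h : scalarMean f x y = 0) : x = 0 ∧ y = 0 := by
  unfold scalarMean at h
  split_ifs at h with h0
  · exact ⟨(mul_eq_zero.1 h).resolve_right hreg, h0⟩
  · have h1 : f (x / y) = 0 := (mul_eq_zero.1 h).resolve_left h0
    have h2 := hf.monotoneOn Set.self_mem_Ici (Set.mem_Ici.2 (by positivity : 0 ≤ x / y))
      (by positivity)
    exact absurd (le_antisymm (h1 ▸ h2) hf.zero_nonneg) hreg

/-- Continuity under a common positive shift of both arguments; it reduces the transformer
inequality to strictly positive weights. -/
theorem tendsto_scalarMean {x y : ℝ} (hx : 0 ≤ x) (hy : 0 ≤ y) :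
    Tendsto (fun e => scalarMean f (x + e) (y + e)) (𝓝[>] 0) (𝓝 (scalarMean f x y)) := by
  have hid : Tendsto (fun e : ℝ => e) (𝓝[>] 0) (𝓝 0) := nhdsWithin_le_nhds
  have hpos : ∀ᶠ e : ℝ in 𝓝[>] 0, 0 < e := eventually_mem_nhdsWithin
  have hxe : Tendsto (fun e : ℝ => x + e) (𝓝[>] 0) (𝓝 x) := by simpa using hid.const_add x
  have hye : Tendsto (fun e : ℝ => y + e) (𝓝[>] 0) (𝓝 y) := by simpa using hid.const_add y
  have hmean : ∀ᶠ e : ℝ in 𝓝[>] 0, (y + e) * f ((x + e) / (y + e)) =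
      scalarMean f (x + e) (y + e) := by
    filter_upwards [hpos] with e he
    rw [scalarMean, if_neg (by positivity)]
  refine Tendsto.congr' hmean ?_
  rcases hy.eq_or_lt with rfl | hy'
  · rw [scalarMean, if_pos rfl]
    -- At `y = 0` the ratio `(x + e) / e` is unbounded if `x > 0`; the symmetry of `f` exchanges the
    -- roles of the arguments and leaves the ratio `e / (x + e)`.
    have h1 : ∀ᶠ e : ℝ in 𝓝[>] 0, (x + e) * f (e / (x + e)) = (0 + e) * f ((x + e) / (0 + e)) := by
      filter_upwards [hpos] with e he
      rw [zero_add, hf.symm ((x + e) / e) (by positivity), one_div_div, ← mul_assoc,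
        mul_div_cancel₀ _ he.ne']
    refine Tendsto.congr' h1 ?_
    rcases hx.eq_or_lt with rfl | hx'
    · have h2 : ∀ᶠ e : ℝ in 𝓝[>] 0, e = (0 + e) * f (e / (0 + e)) := by
        filter_upwards [hpos] with e he
        rw [zero_add, div_self he.ne', hf.map_one, mul_one]
      rw [zero_mul]
      exact hid.congr' h2
    · refine hxe.mul (hf.tendsto_zero.comp (tendsto_nhdsWithin_iff.2 ⟨?_, ?_⟩))
      · have := hid.div hxe hx'.ne'
        rwa [zero_div] at this
      · filter_upwards [hpos] with e he
        exact Set.mem_Ioi.2 (by positivity)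
  · rw [scalarMean, if_neg hy'.ne']
    have hdiv := hxe.div hye hy'.ne'
    refine hye.mul ?_
    rcases hx.eq_or_lt with rfl | hx'
    · rw [zero_div] at hdiv ⊢
      refine hf.tendsto_zero.comp (tendsto_nhdsWithin_iff.2 ⟨hdiv, ?_⟩)
      filter_upwards [hpos] with e he
      exact Set.mem_Ioi.2 (by positivity)
    · exact (hf.tendsto_of_pos (by positivity)).comp hdiv

variable {N N' : Type*} [Fintype N] [Fintype N']

theorem sum_scalarMean_le_of_pos {T : Matrix N N' ℂ} {l r : N → ℝ} {l' r' : N' → ℝ}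
    (hl : ∀ i, 0 < l i) (hr : ∀ i, 0 < r i) (hl' : ∀ j, 0 < l' j) (hr' : ∀ j, 0 < r' j)
    (hL : ∀ x, ∑ i, l i * ‖(T *ᵥ x) i‖ ^ 2 ≤ ∑ j, l' j * ‖x j‖ ^ 2)
    (hR : ∀ x, ∑ i, r i * ‖(T *ᵥ x) i‖ ^ 2 ≤ ∑ j, r' j * ‖x j‖ ^ 2) (x : N' → ℂ) :
    ∑ i, scalarMean f (l i) (r i) * ‖(T *ᵥ x) i‖ ^ 2 ≤
      ∑ j, scalarMean f (l' j) (r' j) * ‖x j‖ ^ 2 := by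
  classical
  -- With `V = r^{1/2} T r'^{-1/2}`, `hR` says that `V` is a contraction and `hL` that `V† (l/r) V ≤
  -- l'/r'`. Jensen's inequality evaluated at `r'^{1/2} x` is then the claim.
  let V : Matrix N N' ℂ := of fun i j => ((√(r i) : ℝ) : ℂ) * T i j * ((√(r' j) : ℝ) : ℂ)⁻¹
  have hV : ∀ x i, (V *ᵥ x) i = ((√(r i) : ℝ) : ℂ) *
      (T *ᵥ fun j => ((√(r' j) : ℝ) : ℂ)⁻¹ * x j) i := by
    intro x i
    simp only [V, mulVec, dotProduct, of_apply, Finset.mul_sum, mul_assoc]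
  have hVn : ∀ x i, ‖(V *ᵥ x) i‖ ^ 2 = r i *
      ‖(T *ᵥ fun j => ((√(r' j) : ℝ) : ℂ)⁻¹ * x j) i‖ ^ 2 := by
    intro x i
    rw [hV, norm_mul, mul_pow, Complex.norm_real, Real.norm_eq_abs, sq_abs, Real.sq_sqrt (hr i).le]
  have hxn : ∀ (x : N' → ℂ) j, ‖((√(r' j) : ℝ) : ℂ)⁻¹ * x j‖ ^ 2 = (r' j)⁻¹ * ‖x j‖ ^ 2 := by
    intro x j
    rw [norm_mul, mul_pow, norm_inv, Complex.norm_real, inv_pow, Real.norm_eq_abs, sq_abs,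
      Real.sq_sqrt (hr' j).le]
  have h := hf.sum_map_le_of_contraction (V := V) (a := fun i => l i / r i)
    (b := fun j => l' j / r' j)
    (fun x => by
      refine (le_of_eq ?_).trans ((hR fun j => ((√(r' j) : ℝ) : ℂ)⁻¹ * x j).trans (le_of_eq ?_))
      · simp only [hVn]
      · refine Finset.sum_congr rfl fun j _ => ?_
        rw [hxn, mul_inv_cancel_left₀ (hr' j).ne'])
    (fun i => (div_pos (hl i) (hr i)).le) (fun j => (div_pos (hl' j) (hr' j)).le)
    (fun x => by
      refine (le_of_eq ?_).trans ((hL fun j => ((√(r' j) : ℝ) : ℂ)⁻¹ * x j).trans (le_of_eq ?_))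
      · refine Finset.sum_congr rfl fun i _ => ?_
        rw [hVn, ← mul_assoc, div_mul_cancel₀ _ (hr i).ne']
      · refine Finset.sum_congr rfl fun j _ => ?_
        rw [hxn, ← mul_assoc, div_eq_mul_inv])
    (fun j => ((√(r' j) : ℝ) : ℂ) * x j)
  have hz : (fun j => ((√(r' j) : ℝ) : ℂ)⁻¹ * (((√(r' j) : ℝ) : ℂ) * x j)) = x := by
    ext j
    exact inv_mul_cancel_left₀ (by exact_mod_cast (Real.sqrt_pos.2 (hr' j)).ne') _
  simp only [hVn, hz] at h
  refine (le_of_eq ?_).trans (h.trans (le_of_eq ?_))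
  · refine Finset.sum_congr rfl fun i _ => ?_
    rw [scalarMean, if_neg (hr i).ne']
    ring
  · refine Finset.sum_congr rfl fun j _ => ?_
    rw [scalarMean, if_neg (hr' j).ne', norm_mul, mul_pow, Complex.norm_real, Real.norm_eq_abs,
      sq_abs, Real.sq_sqrt (hr' j).le]
    ring

/-- The transformer inequality for operator means of diagonal operators. -/
theorem sum_scalarMean_le {T : Matrix N N' ℂ} {l r : N → ℝ} {l' r' : N' → ℝ}
    (hl : ∀ i, 0 ≤ l i) (hr : ∀ i, 0 ≤ r i) (hl' : ∀ j, 0 ≤ l' j) (hr' : ∀ j, 0 ≤ r' j)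
    (hL : ∀ x, ∑ i, l i * ‖(T *ᵥ x) i‖ ^ 2 ≤ ∑ j, l' j * ‖x j‖ ^ 2)
    (hR : ∀ x, ∑ i, r i * ‖(T *ᵥ x) i‖ ^ 2 ≤ ∑ j, r' j * ‖x j‖ ^ 2) (x : N' → ℂ) :
    ∑ i, scalarMean f (l i) (r i) * ‖(T *ᵥ x) i‖ ^ 2 ≤
      ∑ j, scalarMean f (l' j) (r' j) * ‖x j‖ ^ 2 := by
  -- Shifting the source weights by `e` costs at most `e ‖T‖²` on the other side, so the target
  -- weights are shifted by `C * e`. The `+ 1` keeps that shift positive even when `T = 0`.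
  set C : ℝ := (∑ i, ∑ j, ‖T i j‖ ^ 2) + 1 with hC
  have hC0 : 0 < C := by positivity
  have hreg : ∀ {p : N → ℝ} {p' : N' → ℝ},
      (∀ x, ∑ i, p i * ‖(T *ᵥ x) i‖ ^ 2 ≤ ∑ j, p' j * ‖x j‖ ^ 2) → ∀ e : ℝ, 0 < e → ∀ x,
      ∑ i, (p i + e) * ‖(T *ᵥ x) i‖ ^ 2 ≤ ∑ j, (p' j + C * e) * ‖x j‖ ^ 2 := by
    intro p p' h e he x
    simp only [add_mul, Finset.sum_add_distrib, ← Finset.mul_sum]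
    have h1 := mul_le_mul_of_nonneg_left (sum_norm_mulVec_sq_le T x) he.le
    have h2 : 0 ≤ e * ∑ j, ‖x j‖ ^ 2 := by positivity
    nlinarith [h x]
  have hCe : Tendsto (fun e : ℝ => C * e) (𝓝[>] 0) (𝓝[>] 0) := by
    refine tendsto_nhdsWithin_iff.2 ⟨?_, ?_⟩
    · have : Continuous fun e : ℝ => C * e := by fun_prop
      simpa using (this.tendsto 0).mono_left nhdsWithin_le_nhds
    · filter_upwards [eventually_mem_nhdsWithin] with e he
      exact mul_pos hC0 he
  refine le_of_tendsto_of_tendsto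
    (tendsto_finsetSum _ fun i _ => (hf.tendsto_scalarMean (hl i) (hr i)).mul_const _)
    (tendsto_finsetSum _ fun j _ =>
      ((hf.tendsto_scalarMean (hl' j) (hr' j)).comp hCe).mul_const _) ?_
  filter_upwards [eventually_mem_nhdsWithin] with e he
  have he : 0 < e := he
  exact hf.sum_scalarMean_le_of_pos (fun i => add_pos_of_nonneg_of_pos (hl i) he)
    (fun i => add_pos_of_nonneg_of_pos (hr i) he)
    (fun j => add_pos_of_nonneg_of_pos (hl' j) (mul_pos hC0 he))
    (fun j => add_pos_of_nonneg_of_pos (hr' j) (mul_pos hC0 he))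
    (hreg hL e he) (hreg hR e he) x

end IsStandardMonotone

/-! ### Trace norm and trace distance. -/

section TraceNorm

variable {d : Type*} [Fintype d] [DecidableEq d]

theorem traceNorm_eq_sum_abs_eigenvalues {X : Matrix d d ℂ} (hX : X.IsHermitian) :
    traceNorm X = ∑ i, |hX.eigenvalues i| := by
  have tr : ∀ {M : Matrix d d ℂ} (hM : M.IsHermitian) (g : ℝ → ℝ),
      (cfc g M).trace = ((∑ i, g (hM.eigenvalues i) : ℝ) : ℂ) := by
    intro M hM g
    rw [cfc_eq_eigenvectorUnitary_conj hM, trace_mul_comm, ← Matrix.mul_assoc,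
      eigenvectorUnitary_conjTranspose_mul, Matrix.one_mul, trace_diagonal]
    push_cast
    rfl
  have h1 := tr (isHermitian_conjTranspose_mul_self X) Real.sqrt
  have h2 : cfc Real.sqrt (Xᴴ * X) = cfc (fun x : ℝ => |x|) X := by
    have := cfc_comp_pow (R := ℝ) Real.sqrt 2 X (by fun_prop) hX
    simp only [Real.sqrt_sq_eq_abs] at this
    rw [hX.eq, this, sq]
  rw [h2, tr hX] at h1
  exact_mod_cast h1.symm

/-- In the eigenbasis of `A - B` each eigenvalue is a difference of nonnegative diagonal entries, so
its modulus is at most their sum. With `exists_posSemidef_sub_eq`, this makes the trace norm the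
minimum of `Tr (A + B)` over decompositions, which gives the triangle inequality and contractivity
under channels. -/
theorem traceNorm_sub_le {A B : Matrix d d ℂ} (hA : A.PosSemidef) (hB : B.PosSemidef) :
    traceNorm (A - B) ≤ (A.trace + B.trace).re := by
  have hX := hA.isHermitian.sub hB.isHermitian
  rw [traceNorm_eq_sum_abs_eigenvalues hX]
  set U := (hX.eigenvectorUnitary : Matrix d d ℂ)
  have hU : U * Uᴴ = 1 := eigenvectorUnitary_mul_conjTranspose hX
  have hd : Uᴴ * A * U - Uᴴ * B * U = realDiag hX.eigenvalues := by
    rw [← Matrix.sub_mul, ← Matrix.mul_sub]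
    exact conj_eigenvectorUnitary_eq hX
  have htr : ∀ Z : Matrix d d ℂ, Z.trace.re = ∑ i, ((Uᴴ * Z * U) i i).re := fun Z => by
    have : Z.trace = (Uᴴ * Z * U).trace := by
      rw [trace_mul_comm, ← Matrix.mul_assoc, hU, Matrix.one_mul]
    rw [this, trace, Complex.re_sum]
    rfl
  rw [Complex.add_re, htr, htr, ← Finset.sum_add_distrib]
  refine Finset.sum_le_sum fun i _ => ?_
  have h1 := congrArg Complex.re (congrFun (congrFun hd i) i)
  rw [realDiag, diagonal_apply_eq, Complex.ofReal_re, Matrix.sub_apply, Complex.sub_re] at h1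
  have h2 : 0 ≤ ((Uᴴ * A * U) i i).re :=
    (Complex.le_def.1 (hA.conjTranspose_mul_mul_same U).diag_nonneg).1
  have h3 : 0 ≤ ((Uᴴ * B * U) i i).re :=
    (Complex.le_def.1 (hB.conjTranspose_mul_mul_same U).diag_nonneg).1
  rw [← h1, abs_le]
  constructor <;> linarith

theorem exists_posSemidef_sub_eq {X : Matrix d d ℂ} (hX : X.IsHermitian) :
    ∃ A B : Matrix d d ℂ, A.PosSemidef ∧ B.PosSemidef ∧ X = A - B ∧
      traceNorm X = (A.trace + B.trace).re := by
  set U := (hX.eigenvectorUnitary : Matrix d d ℂ)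
  have hU' : Uᴴ * U = 1 := eigenvectorUnitary_conjTranspose_mul hX
  have hs : X = U * realDiag hX.eigenvalues * Uᴴ := eq_eigenvectorUnitary_conj hX
  refine ⟨U * realDiag (fun i => (hX.eigenvalues i)⁺) * Uᴴ,
    U * realDiag (fun i => (hX.eigenvalues i)⁻) * Uᴴ,
    (posSemidef_realDiag fun i => posPart_nonneg _).mul_mul_conjTranspose_same U,
    (posSemidef_realDiag fun i => negPart_nonneg _).mul_mul_conjTranspose_same U, ?_, ?_⟩
  · rw [← Matrix.sub_mul, ← Matrix.mul_sub, diagonal_sub]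
    simp only [← Complex.ofReal_sub, posPart_sub_negPart]
    exact hs
  · rw [traceNorm_eq_sum_abs_eigenvalues hX, ← trace_add, ← Matrix.add_mul, ← Matrix.mul_add,
      diagonal_add, trace_mul_comm, ← Matrix.mul_assoc, hU', Matrix.one_mul, trace_diagonal]
    simp only [← Complex.ofReal_add, posPart_add_negPart, Complex.re_sum, Complex.ofReal_re]

theorem traceDist_triangle {X Y Z : Matrix d d ℂ} (hX : X.IsHermitian) (hY : Y.IsHermitian)
    (hZ : Z.IsHermitian) : traceDist X Z ≤ traceDist X Y + traceDist Y Z := by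
  obtain ⟨A, B, hA, hB, h1, h2⟩ := exists_posSemidef_sub_eq (hX.sub hY)
  obtain ⟨A', B', hA', hB', h1', h2'⟩ := exists_posSemidef_sub_eq (hY.sub hZ)
  have h := traceNorm_sub_le (hA.add hA') (hB.add hB')
  have e : X - Z = A + A' - (B + B') := by
    rw [← sub_add_sub_cancel X Y Z, h1, h1']
    abel
  rw [← e] at h
  simp only [trace_add, Complex.add_re] at h h2 h2'
  unfold traceDist
  linarith

theorem traceDist_comm {X Y : Matrix d d ℂ} (hX : X.IsHermitian) (hY : Y.IsHermitian) :
    traceDist X Y = traceDist Y X := by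
  have key : ∀ {X Y : Matrix d d ℂ}, X.IsHermitian → Y.IsHermitian →
      traceDist X Y ≤ traceDist Y X := fun {X Y} hX hY => by
    obtain ⟨A, B, hA, hB, h1, h2⟩ := exists_posSemidef_sub_eq (hY.sub hX)
    have h := traceNorm_sub_le hB hA
    rw [← neg_sub A B, ← h1, neg_sub, add_comm, ← h2] at h
    unfold traceDist
    linarith
  exact le_antisymm (key hX hY) (key hY hX)

theorem traceDist_self (X : Matrix d d ℂ) : traceDist X X = 0 := by
  have h := traceNorm_eq_sum_abs_eigenvalues (isHermitian_zero (n := d) (α := ℂ))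
  have h0 : (isHermitian_zero (n := d) (α := ℂ)).eigenvalues = 0 :=
    (isHermitian_zero (n := d) (α := ℂ)).eigenvalues_eq_zero_iff.2 rfl
  rw [h0] at h
  rw [traceDist, sub_self, h]
  simp

end TraceNorm

/-! ### Channels, their trace duals and the Schwarz inequality. -/

section Channels

variable {d : Type*} {d' : Type*} [Fintype d] [DecidableEq d] [Fintype d'] [DecidableEq d']

omit [DecidableEq d'] in
theorem conjTranspose_mul_comp_mul {n : ℕ} (M : Matrix (Fin n) (Fin n) (Matrix d' d' ℂ))
    (S : Fin n → Matrix d' d' ℂ) :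
    (of fun (p : Fin n × d') j => S p.1 p.2 j)ᴴ * Matrix.comp (Fin n) (Fin n) d' d' ℂ M *
      (of fun (p : Fin n × d') j => S p.1 p.2 j) = ∑ a, ∑ b, (S a)ᴴ * M a b * S b := by
  ext i j
  simp only [Matrix.mul_apply, Fintype.sum_prod_type, Matrix.sum_apply, conjTranspose_apply,
    of_apply, comp_apply, Finset.sum_mul]
  conv_rhs => rw [Finset.sum_comm]
  exact Finset.sum_congr rfl fun b _ => Finset.sum_comm

/-- The trace dual (Heisenberg picture) of a linear map of matrices. -/
noncomputable def traceDual (E : Matrix d d ℂ →ₗ[ℂ] Matrix d' d' ℂ) :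
    Matrix d' d' ℂ →ₗ[ℂ] Matrix d d ℂ where
  toFun X := of fun i j => (E (single j i 1) * X).trace
  map_add' X Y := by
    ext i j
    simp [Matrix.mul_add]
  map_smul' c X := by
    ext i j
    simp

theorem trace_mul_traceDual (E : Matrix d d ℂ →ₗ[ℂ] Matrix d' d' ℂ) (Z : Matrix d d ℂ)
    (X : Matrix d' d' ℂ) : (Z * traceDual E X).trace = (E Z * X).trace := by
  have h : ∀ i j, single i j (Z i j) = Z i j • single i j (1 : ℂ) := fun i j => by
    rw [smul_single, smul_eq_mul, mul_one]
  conv_rhs => rw [matrix_eq_sum_single Z]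
  simp only [h, map_sum, map_smul, Finset.sum_mul, trace_sum, smul_mul_assoc, trace_smul]
  rfl

namespace IsChannel

variable {E : Matrix d d ℂ →ₗ[ℂ] Matrix d' d' ℂ} (hE : IsChannel E)
include hE

-- The input block matrix is `R ρ R†` for the block column `R`. Special choices of `R` give
-- positivity, compatibility with adjoints and the Schwarz inequality.
omit [DecidableEq d] [DecidableEq d'] in
theorem posSemidef_blocks {n : ℕ} {ρ : Matrix d d ℂ} (hρ : ρ.PosSemidef)
    (R : Fin n → Matrix d d ℂ) :
    (Matrix.comp (Fin n) (Fin n) d' d' ℂ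
      ((of fun a b => R a * ρ * (R b)ᴴ).map E)).PosSemidef := by
  apply hE.completely_positive
  convert hρ.mul_mul_conjTranspose_same (of fun (p : Fin n × d) j => R p.1 p.2 j) using 1
  ext ⟨a, i⟩ ⟨b, j⟩
  rfl

omit [DecidableEq d'] in
theorem map_posSemidef {ρ : Matrix d d ℂ} (hρ : ρ.PosSemidef) : (E ρ).PosSemidef := by
  have := (hE.posSemidef_blocks hρ (n := 1) fun _ => 1).submatrix fun i => ((0 : Fin 1), i)
  convert this using 1
  ext i j
  simp

-- For `ρ = 1` and blocks `Z`, `1`, the off-diagonal blocks of the output are `E Z` and `E Zᴴ`; a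
-- positive semidefinite matrix is Hermitian.
omit [DecidableEq d'] in
theorem map_conjTranspose (Z : Matrix d d ℂ) : E Zᴴ = (E Z)ᴴ := by
  ext i j
  have := congrFun (congrFun
    (hE.posSemidef_blocks (PosSemidef.one (n := d)) ![Z, 1]).isHermitian (1, i)) (0, j)
  simpa using this.symm

theorem traceDual_conjTranspose (X : Matrix d' d' ℂ) : traceDual E Xᴴ = (traceDual E X)ᴴ := by
  ext i j
  change (E (single j i 1) * Xᴴ).trace = star (E (single i j 1) * X).trace
  rw [← trace_conjTranspose, conjTranspose_mul, ← hE.map_conjTranspose, conjTranspose_single,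
    star_one, trace_mul_comm]

/-- The Kadison–Schwarz inequality for the trace dual of a channel. -/
theorem re_trace_traceDual_le {ρ : Matrix d d ℂ} (hρ : ρ.PosSemidef) (X : Matrix d' d' ℂ) :
    ((traceDual E X)ᴴ * ρ * traceDual E X).trace.re ≤ (Xᴴ * E ρ * X).trace.re := by
  set Y := traceDual E X with hY
  -- Compressing the `2 × 2` block matrix by the column `(1, -X)` gives a positive matrix. In its
  -- trace, trace preservation and duality turn the first three terms into `Tr Y†ρY` with signs `+`,
  -- `-`, `-`.
  have h := ((hE.posSemidef_blocks hρ ![Yᴴ, 1]).conjTranspose_mul_mul_same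
    (of fun (p : Fin 2 × d') j => (![1, -X] : Fin 2 → Matrix d' d' ℂ) p.1 p.2 j)).trace_nonneg
  have e : ((of fun (p : Fin 2 × d') j => (![1, -X] : Fin 2 → Matrix d' d' ℂ) p.1 p.2 j)ᴴ *
      Matrix.comp (Fin 2) (Fin 2) d' d' ℂ
        ((of fun a b => ![Yᴴ, 1] a * ρ * (![Yᴴ, 1] b)ᴴ).map E) *
      (of fun (p : Fin 2 × d') j => (![1, -X] : Fin 2 → Matrix d' d' ℂ) p.1 p.2 j)) =
      E (Yᴴ * ρ * Y) - E (Yᴴ * ρ) * X - Xᴴ * E (ρ * Y) + Xᴴ * E ρ * X := by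
    rw [conjTranspose_mul_comp_mul]
    simp only [Fin.sum_univ_two, map_apply, of_apply, cons_val_zero, cons_val_one,
      conjTranspose_conjTranspose, conjTranspose_one, conjTranspose_neg, Matrix.one_mul,
      Matrix.mul_one, Matrix.mul_neg, Matrix.neg_mul]
    abel
  rw [e, trace_add, trace_sub, trace_sub, hE.trace_preserving, ← trace_mul_traceDual, ← hY] at h
  have h2 : (Xᴴ * E (ρ * Y)).trace = star (Yᴴ * ρ * Y).trace := by
    rw [trace_mul_comm, ← trace_mul_traceDual, hE.traceDual_conjTranspose, ← hY,
      ← trace_conjTranspose, conjTranspose_mul, conjTranspose_mul, conjTranspose_conjTranspose,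
      hρ.isHermitian.eq, trace_mul_comm]
  rw [h2] at h
  have h3 := (Complex.le_def.1 h).1
  simp at h3
  linarith

theorem re_trace_traceDual_le' {ρ : Matrix d d ℂ} (hρ : ρ.PosSemidef) (X : Matrix d' d' ℂ) :
    (traceDual E X * ρ * (traceDual E X)ᴴ).trace.re ≤ (X * E ρ * Xᴴ).trace.re := by
  simpa [hE.traceDual_conjTranspose] using hE.re_trace_traceDual_le hρ Xᴴ

theorem traceDist_map_le {X Y : Matrix d d ℂ} (hX : X.IsHermitian) (hY : Y.IsHermitian) :
    traceDist (E X) (E Y) ≤ traceDist X Y := by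
  obtain ⟨A, B, hA, hB, h1, h2⟩ := exists_posSemidef_sub_eq (hX.sub hY)
  have h := traceNorm_sub_le (hE.map_posSemidef hA) (hE.map_posSemidef hB)
  rw [← map_sub, ← h1, map_sub, hE.trace_preserving, hE.trace_preserving, ← h2] at h
  unfold traceDist
  linarith

end IsChannel

end Channels

/-! ### Contraction of the monotone metrics under channels. -/

section FisherMonotone

variable {d : Type*} {d' : Type*} [Fintype d] [DecidableEq d] [Fintype d'] [DecidableEq d']

-- Matrices are treated as vectors indexed by pairs `(i, j)`, on which left and right multiplication
-- by a diagonal matrix are diagonal with weights `l i` and `l j`.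
omit [DecidableEq d] in
theorem IsStandardMonotone.sum_scalarMean_le_linearMap {f : ℝ → ℝ} (hf : IsStandardMonotone f)
    (T : Matrix d' d' ℂ →ₗ[ℂ] Matrix d d ℂ) {l : d → ℝ} {l' : d' → ℝ}
    (hl : ∀ i, 0 ≤ l i) (hl' : ∀ i, 0 ≤ l' i)
    (hL : ∀ x, ∑ i, ∑ j, l i * ‖T x i j‖ ^ 2 ≤ ∑ i, ∑ j, l' i * ‖x i j‖ ^ 2)
    (hR : ∀ x, ∑ i, ∑ j, l j * ‖T x i j‖ ^ 2 ≤ ∑ i, ∑ j, l' j * ‖x i j‖ ^ 2)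
    (x : Matrix d' d' ℂ) :
    ∑ i, ∑ j, scalarMean f (l i) (l j) * ‖T x i j‖ ^ 2 ≤
      ∑ i, ∑ j, scalarMean f (l' i) (l' j) * ‖x i j‖ ^ 2 := by
  let T' : (d' × d' → ℂ) →ₗ[ℂ] (d × d → ℂ) :=
    { toFun := fun y p => T (of fun i j => y (i, j)) p.1 p.2
      map_add' := fun y z => by
        ext p
        exact congrFun (congrFun (map_add T (of fun i j => y (i, j)) (of fun i j => z (i, j)))
          p.1) p.2
      map_smul' := fun c y => by
        ext p
        exact congrFun (congrFun (map_smul T c (of fun i j => y (i, j))) p.1) p.2 }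
  have hT' : ∀ y p, T' y p = T (of fun i j => y (i, j)) p.1 p.2 := fun _ _ => rfl
  have h := hf.sum_scalarMean_le (T := LinearMap.toMatrix' T')
    (l := fun p => l p.1) (r := fun p => l p.2) (l' := fun p => l' p.1) (r' := fun p => l' p.2)
    (fun _ => hl _) (fun _ => hl _) (fun _ => hl' _) (fun _ => hl' _)
    (fun y => by
      simpa only [LinearMap.toMatrix'_mulVec, Fintype.sum_prod_type, hT', of_apply] using
        hL (of fun i j => y (i, j)))
    (fun y => by
      simpa only [LinearMap.toMatrix'_mulVec, Fintype.sum_prod_type, hT', of_apply] using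
        hR (of fun i j => y (i, j)))
    (fun p => x p.1 p.2)
  simp only [LinearMap.toMatrix'_mulVec, Fintype.sum_prod_type, hT'] at h
  exact h

theorem re_trace_conjTranspose_realDiag_mul (l : d → ℝ) (y : Matrix d d ℂ) :
    (yᴴ * realDiag l * y).trace.re = ∑ i, ∑ j, l i * ‖y i j‖ ^ 2 := by
  rw [Matrix.mul_assoc]
  simp only [trace, diag_apply, Matrix.mul_apply (M := yᴴ), diagonal_mul, conjTranspose_apply]
  rw [Finset.sum_comm, Complex.re_sum]
  refine Finset.sum_congr rfl fun i _ => ?_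
  rw [Complex.re_sum]
  refine Finset.sum_congr rfl fun j _ => ?_
  rw [← Complex.ofReal_re (l i * ‖y i j‖ ^ 2)]
  congr 1
  push_cast
  rw [← Complex.conj_mul', Complex.star_def]
  ring

theorem re_trace_mul_realDiag_conjTranspose (l : d → ℝ) (y : Matrix d d ℂ) :
    (y * realDiag l * yᴴ).trace.re = ∑ i, ∑ j, l j * ‖y i j‖ ^ 2 := by
  have h := re_trace_conjTranspose_realDiag_mul l yᴴ
  rw [conjTranspose_conjTranspose] at h
  rw [h, Finset.sum_comm]
  simp

/-- The matrix of `X` in the eigenbasis of `ρ`. -/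
noncomputable def eigenbasisMatrix {ρ : Matrix d d ℂ} (hρ : ρ.IsHermitian) (X : Matrix d d ℂ) :
    Matrix d d ℂ :=
  (hρ.eigenvectorUnitary : Matrix d d ℂ)ᴴ * X * (hρ.eigenvectorUnitary : Matrix d d ℂ)

/-- The monotone metric `∑ c_f(λ_i, λ_j) |⟨i|X|j⟩|²` at `ρ`. -/
noncomputable def metricForm (f : ℝ → ℝ) {ρ : Matrix d d ℂ} (hρ : ρ.IsHermitian)
    (X : Matrix d d ℂ) : ℝ :=
  ∑ i, ∑ j, (scalarMean f (hρ.eigenvalues i) (hρ.eigenvalues j))⁻¹ *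
    ‖eigenbasisMatrix hρ X i j‖ ^ 2

theorem trace_eigenbasisMatrix_mul {ρ : Matrix d d ℂ} (hρ : ρ.IsHermitian) (Z y : Matrix d d ℂ) :
    (eigenbasisMatrix hρ Z * y).trace = (Z * ((hρ.eigenvectorUnitary : Matrix d d ℂ) * y *
      (hρ.eigenvectorUnitary : Matrix d d ℂ)ᴴ)).trace := by
  rw [eigenbasisMatrix, Matrix.mul_assoc, Matrix.mul_assoc, trace_mul_comm]
  simp only [Matrix.mul_assoc]

omit [DecidableEq d] in
theorem trace_conjTranspose_mul_eq_sum (A B : Matrix d d ℂ) :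
    (Aᴴ * B).trace = ∑ i, ∑ j, star (A i j) * B i j := by
  simp only [trace, diag_apply, Matrix.mul_apply, conjTranspose_apply]
  exact Finset.sum_comm

/-- The transformer inequality applies to the dual map and the forms weighted by the mean; the
metric has the inverse weights, so the inequality reverses direction. The hypothesis `hD` makes up
for the convention `0⁻¹ = 0` at entries of zero weight. -/
theorem IsChannel.metricForm_le {f : ℝ → ℝ} (hf : IsStandardMonotone f)
    {E : Matrix d d ℂ →ₗ[ℂ] Matrix d' d' ℂ} (hE : IsChannel E)
    {ρ : Matrix d d ℂ} (hρ : ρ.PosSemidef) (hEρ : (E ρ).PosSemidef) {D : Matrix d d ℂ}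
    (hD : ∀ i j, scalarMean f (hρ.isHermitian.eigenvalues i) (hρ.isHermitian.eigenvalues j) = 0 →
      eigenbasisMatrix hρ.isHermitian D i j = 0) :
    metricForm f hEρ.isHermitian (E D) ≤ metricForm f hρ.isHermitian D := by
  set l := hρ.isHermitian.eigenvalues with hl_def
  set l' := hEρ.isHermitian.eigenvalues with hl'_def
  set U := (hρ.isHermitian.eigenvectorUnitary : Matrix d d ℂ)
  set U' := (hEρ.isHermitian.eigenvectorUnitary : Matrix d' d' ℂ)
  have hl : ∀ i, 0 ≤ l i := hρ.eigenvalues_nonneg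
  have hl' : ∀ i, 0 ≤ l' i := hEρ.eigenvalues_nonneg
  have hU : U * Uᴴ = 1 := eigenvectorUnitary_mul_conjTranspose _
  have hU' : U'ᴴ * U' = 1 := eigenvectorUnitary_conjTranspose_mul _
  have hρU : ρ = U * realDiag l * Uᴴ := eq_eigenvectorUnitary_conj _
  have hEU : E ρ = U' * realDiag l' * U'ᴴ := eq_eigenvectorUnitary_conj _
  -- The trace dual written in the eigenbases of `E ρ` and `ρ`, so that `hL` and `hR` become the two
  -- Schwarz inequalities.
  let T : Matrix d' d' ℂ →ₗ[ℂ] Matrix d d ℂ :=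
    (LinearMap.mulLeft ℂ Uᴴ).comp ((LinearMap.mulRight ℂ U).comp
      ((traceDual E).comp ((LinearMap.mulLeft ℂ U').comp (LinearMap.mulRight ℂ U'ᴴ))))
  have hT : ∀ x, T x = Uᴴ * traceDual E (U' * x * U'ᴴ) * U := fun x => by
    simp [T, Matrix.mul_assoc]
  have hTH : ∀ x, (T x)ᴴ = Uᴴ * (traceDual E (U' * x * U'ᴴ))ᴴ * U := fun x => by
    simp [hT, Matrix.mul_assoc]
  have hcyc : ∀ Z : Matrix d d ℂ, (Uᴴ * Z * U).trace = Z.trace := fun Z => by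
    rw [trace_mul_comm, ← Matrix.mul_assoc, hU, Matrix.one_mul]
  have hL : ∀ x, ∑ i, ∑ j, l i * ‖T x i j‖ ^ 2 ≤ ∑ i, ∑ j, l' i * ‖x i j‖ ^ 2 := fun x => by
    rw [← re_trace_conjTranspose_realDiag_mul, ← re_trace_conjTranspose_realDiag_mul]
    convert hE.re_trace_traceDual_le hρ (U' * x * U'ᴴ) using 2
    · conv_rhs => rw [← hcyc]
      rw [hTH, hT]
      conv_rhs => rw [hρU]
      simp only [Matrix.mul_assoc]
    · have : (U' * x * U'ᴴ)ᴴ * E ρ * (U' * x * U'ᴴ) =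
        U' * (xᴴ * (U'ᴴ * U') * realDiag l' * (U'ᴴ * U') * x * U'ᴴ) := by
        rw [hEU]
        simp [Matrix.mul_assoc]
      conv_rhs => rw [this, trace_mul_comm, hU']
      simp [Matrix.mul_assoc, hU']
  have hR : ∀ x, ∑ i, ∑ j, l j * ‖T x i j‖ ^ 2 ≤ ∑ i, ∑ j, l' j * ‖x i j‖ ^ 2 := fun x => by
    rw [← re_trace_mul_realDiag_conjTranspose, ← re_trace_mul_realDiag_conjTranspose]
    convert hE.re_trace_traceDual_le' hρ (U' * x * U'ᴴ) using 2
    · conv_rhs => rw [← hcyc]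
      rw [hTH, hT]
      conv_rhs => rw [hρU]
      simp only [Matrix.mul_assoc]
    · have : (U' * x * U'ᴴ) * E ρ * (U' * x * U'ᴴ)ᴴ =
        U' * (x * (U'ᴴ * U') * realDiag l' * (U'ᴴ * U') * xᴴ * U'ᴴ) := by
        rw [hEU]
        simp [Matrix.mul_assoc]
      conv_rhs => rw [this, trace_mul_comm, hU']
      simp [Matrix.mul_assoc, hU']
  set k : d → d → ℝ := fun i j => scalarMean f (l i) (l j) with hk
  set k' : d' → d' → ℝ := fun i j => scalarMean f (l' i) (l' j) with hk'
  have hk0 : ∀ i j, 0 ≤ k i j := fun i j => hf.scalarMean_nonneg (hl i) (hl j)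
  set B := eigenbasisMatrix hρ.isHermitian D with hB
  set B' := eigenbasisMatrix hEρ.isHermitian (E D) with hB'
  -- This is the optimal vector in the duality: its form with weights `k'` and its pairing with `B'`
  -- both equal the metric at `E ρ`.
  let w : Matrix d' d' ℂ := of fun i j => ((k' i j : ℝ) : ℂ)⁻¹ * B' i j
  have hw : ∑ i, ∑ j, k' i j * ‖w i j‖ ^ 2 = metricForm f hEρ.isHermitian (E D) := by
    refine Finset.sum_congr rfl fun i _ => Finset.sum_congr rfl fun j _ => ?_
    change k' i j * ‖((k' i j : ℝ) : ℂ)⁻¹ * B' i j‖ ^ 2 = (k' i j)⁻¹ * ‖B' i j‖ ^ 2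
    rw [norm_mul, mul_pow, norm_inv, Complex.norm_real, inv_pow, Real.norm_eq_abs, sq_abs]
    by_cases h : k' i j = 0
    · simp [h]
    · field_simp
  have hpair : (metricForm f hEρ.isHermitian (E D) : ℂ) = ((T w)ᴴ * B).trace := by
    have h1 : (metricForm f hEρ.isHermitian (E D) : ℂ) = (wᴴ * B').trace := by
      rw [trace_conjTranspose_mul_eq_sum, metricForm]
      push_cast
      refine Finset.sum_congr rfl fun i _ => Finset.sum_congr rfl fun j _ => ?_
      change ((k' i j : ℝ) : ℂ)⁻¹ * (‖B' i j‖ : ℂ) ^ 2 = star (((k' i j : ℝ) : ℂ)⁻¹ * B' i j) * B' i j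
      rw [← Complex.conj_mul']
      simp only [Complex.star_def, map_mul, map_inv₀, Complex.conj_ofReal]
      ring
    have hTw : U * (T w)ᴴ * Uᴴ = traceDual E (U' * wᴴ * U'ᴴ) := by
      have : U * (T w)ᴴ * Uᴴ = (U * Uᴴ) * (traceDual E (U' * w * U'ᴴ))ᴴ * (U * Uᴴ) := by
        rw [hTH]
        simp only [Matrix.mul_assoc]
      rw [this, hU, Matrix.one_mul, Matrix.mul_one, ← hE.traceDual_conjTranspose]
      simp [Matrix.mul_assoc]
    rw [h1, trace_mul_comm, hB', trace_eigenbasisMatrix_mul, ← trace_mul_traceDual,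
      trace_mul_comm _ B, hB, trace_eigenbasisMatrix_mul, hTw]
  -- The pairing `⟨w, B'⟩ = ⟨T w, B⟩` is bounded entrywise by the arithmetic-geometric mean
  -- inequality. The first half is at most half the left side by `hmain`, and is absorbed there.
  have hre : metricForm f hEρ.isHermitian (E D) ≤
      ∑ i, ∑ j, (1 / 2) * (k i j * ‖T w i j‖ ^ 2 + (k i j)⁻¹ * ‖B i j‖ ^ 2) := by
    have h2 := congrArg Complex.re hpair
    rw [Complex.ofReal_re, trace_conjTranspose_mul_eq_sum, Complex.re_sum] at h2
    rw [h2]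
    refine Finset.sum_le_sum fun i _ => ?_
    rw [Complex.re_sum]
    refine Finset.sum_le_sum fun j _ => ?_
    refine (Complex.re_le_norm _).trans ?_
    rw [norm_mul, norm_star]
    by_cases h : k i j = 0
    · rw [hD i j h, h]
      simp
    · have hpos : 0 < k i j := lt_of_le_of_ne (hk0 i j) (Ne.symm h)
      have h3 : (1 / 2) * (k i j * ‖T w i j‖ ^ 2 + (k i j)⁻¹ * ‖B i j‖ ^ 2) -
          ‖T w i j‖ * ‖B i j‖ =
          (1 / 2) * (k i j)⁻¹ * (k i j * ‖T w i j‖ - ‖B i j‖) ^ 2 := by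
        field_simp
        ring
      have h4 : 0 ≤ (1 / 2) * (k i j)⁻¹ * (k i j * ‖T w i j‖ - ‖B i j‖) ^ 2 := by positivity
      linarith
  have hmain := hf.sum_scalarMean_le_linearMap T hl hl' hL hR w
  simp only [← Finset.mul_sum, Finset.sum_add_distrib] at hre
  change ∑ i, ∑ j, k i j * ‖T w i j‖ ^ 2 ≤ ∑ i, ∑ j, k' i j * ‖w i j‖ ^ 2 at hmain
  rw [hw] at hmain
  change _ ≤ 1 / 2 * (_ + metricForm f hρ.isHermitian D) at hre
  linarith

end FisherMonotone

/-! ### Skew information as the metric of the commutator. -/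

section TimeEvolution

variable {d : Type*} [Fintype d] [DecidableEq d]

theorem timeUnitary_zero (H : Hamiltonian d) : timeUnitary H 0 = 1 := by
  simp [timeUnitary, NormedSpace.exp_zero]

/-- The generator `X ↦ -i [H, X]` of the time evolution. -/
noncomputable def liouvillian (H : Hamiltonian d) (X : Matrix d d ℂ) : Matrix d d ℂ :=
  -Complex.I • (H.mat * X - X * H.mat)

open scoped Matrix.Norms.Operator in
theorem hasDerivAt_conjEvolve (H : Hamiltonian d) (X : Matrix d d ℂ) (i j : d) :
    HasDerivAt (fun t => conjEvolve H t X i j) (liouvillian H X i j) 0 := by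
  have hexp : ∀ c : ℂ, HasDerivAt (fun t : ℝ => NormedSpace.exp (t • c • H.mat)) (c • H.mat) 0 :=
    fun c => by
      have := hasDerivAt_exp_smul_const (𝕂 := ℝ) (c • H.mat) 0
      rwa [zero_smul, NormedSpace.exp_zero, one_mul] at this
  have e1 : ∀ t, timeUnitary H t = NormedSpace.exp (t • -Complex.I • H.mat) := fun t => by
    unfold timeUnitary
    congr 1
    ext i j
    simp only [Matrix.smul_apply, smul_eq_mul, Complex.real_smul]
    ring
  have e2 : ∀ t, (timeUnitary H t)ᴴ = NormedSpace.exp (t • Complex.I • H.mat) := fun t => by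
    rw [conjTranspose_timeUnitary]
    congr 1
    ext i j
    simp only [Matrix.smul_apply, smul_eq_mul, Complex.real_smul]
    ring
  have h := ((hexp (-Complex.I)).mul_const X).mul (hexp Complex.I)
  have hL := (LinearMap.toContinuousLinearMap
    (Matrix.entryLinearMap ℝ ℂ i j)).hasFDerivAt.comp_hasDerivAt 0 h
  refine (hL.congr_deriv ?_).congr_of_eventuallyEq (Eventually.of_forall fun t => ?_)
  · rw [zero_smul, zero_smul, NormedSpace.exp_zero, Matrix.mul_one, Matrix.one_mul]
    change (-Complex.I • H.mat * X + X * Complex.I • H.mat) i j = _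
    simp [liouvillian]
    ring
  · change (timeUnitary H t * X * (timeUnitary H t)ᴴ) i j = _
    rw [e2, e1]
    rfl

theorem stateDeriv_evolve (ρ : State d) (H : Hamiltonian d) :
    stateDeriv (fun t => ρ.evolve H t) 0 = liouvillian H ρ.mat := by
  ext i j
  exact (hasDerivAt_conjEvolve H ρ.mat i j).deriv

theorem evolve_zero (ρ : State d) (H : Hamiltonian d) : ρ.evolve H 0 = ρ := by
  cases ρ
  simp [State.evolve, conjEvolve, timeUnitary_zero]

omit [DecidableEq d] in
theorem isHermitian_liouvillian (H : Hamiltonian d) {X : Matrix d d ℂ} (hX : X.IsHermitian) :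
    (liouvillian H X).IsHermitian := by
  rw [Matrix.IsHermitian, liouvillian, conjTranspose_smul, conjTranspose_sub, conjTranspose_mul,
    conjTranspose_mul, hX.eq, H.isHermitian.eq, star_neg, Complex.star_def, Complex.conj_I,
    ← neg_sub, smul_neg, ← neg_smul, neg_neg]

/-- The entry is `-i (λ_j - λ_i) ⟨i|H|j⟩`. With regularity, which confines the zeros of the mean to
`λ_i = λ_j = 0`, this supplies the vanishing hypothesis of `IsChannel.metricForm_le`. -/
theorem eigenbasisMatrix_liouvillian_eq_zero (H : Hamiltonian d) {ρ : Matrix d d ℂ}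
    (hρ : ρ.IsHermitian) {i j : d} (h : hρ.eigenvalues i = hρ.eigenvalues j) :
    eigenbasisMatrix hρ (liouvillian H ρ) i j = 0 := by
  set U := (hρ.eigenvectorUnitary : Matrix d d ℂ) with hU_def
  have hU : U * Uᴴ = 1 := eigenvectorUnitary_mul_conjTranspose hρ
  have hd : Uᴴ * ρ * U = realDiag hρ.eigenvalues := conj_eigenvectorUnitary_eq hρ
  have h1 : Uᴴ * (H.mat * ρ) * U = Uᴴ * H.mat * U * realDiag hρ.eigenvalues := by
    rw [← hd]
    calc _ = Uᴴ * H.mat * 1 * ρ * U := by simp only [Matrix.mul_assoc, Matrix.one_mul]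
      _ = _ := by rw [← hU]; simp only [Matrix.mul_assoc]
  have h2 : Uᴴ * (ρ * H.mat) * U = realDiag hρ.eigenvalues * (Uᴴ * H.mat * U) := by
    rw [← hd]
    calc _ = Uᴴ * ρ * 1 * H.mat * U := by simp only [Matrix.mul_assoc, Matrix.one_mul]
      _ = _ := by rw [← hU]; simp only [Matrix.mul_assoc]
  have h3 : eigenbasisMatrix hρ (liouvillian H ρ) =
      -Complex.I • (Uᴴ * H.mat * U * realDiag hρ.eigenvalues -
        realDiag hρ.eigenvalues * (Uᴴ * H.mat * U)) := by
    rw [eigenbasisMatrix, liouvillian, ← h1, ← h2, Matrix.mul_smul, Matrix.smul_mul,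
      Matrix.mul_sub, Matrix.sub_mul]
  rw [h3, Matrix.smul_apply, Matrix.sub_apply, mul_diagonal, diagonal_mul, h]
  ring_nf

theorem re_trace_mul_mcSuperop (f : ℝ → ℝ) (ρ : State d) {D : Matrix d d ℂ}
    (hD : D.IsHermitian) :
    (D * mcSuperop f ρ D).trace.re = metricForm f ρ.posSemidef.isHermitian D := by
  set hρ := ρ.posSemidef.isHermitian
  have hB : (eigenbasisMatrix hρ D).IsHermitian := isHermitian_conjTranspose_mul_mul _ hD
  have h : D * mcSuperop f ρ D = D * ((hρ.eigenvectorUnitary : Matrix d d ℂ) *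
    (of fun i j => ((morozovaChentsov f (hρ.eigenvalues i) (hρ.eigenvalues j) : ℝ) : ℂ) *
      eigenbasisMatrix hρ D i j) * (hρ.eigenvectorUnitary : Matrix d d ℂ)ᴴ) := rfl
  rw [h, ← trace_eigenbasisMatrix_mul, ← hB.eq, trace_conjTranspose_mul_eq_sum, metricForm,
    Complex.re_sum]
  refine Finset.sum_congr rfl fun i _ => ?_
  rw [Complex.re_sum]
  refine Finset.sum_congr rfl fun j _ => ?_
  rw [of_apply, morozovaChentsov_eq_inv, ← Complex.ofReal_re (_ * ‖_‖ ^ 2)]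
  congr 1
  push_cast
  rw [hB.eq, ← Complex.conj_mul', Complex.star_def]
  ring

theorem skewInfo_eq (f : ℝ → ℝ) (ρ : State d) (H : Hamiltonian d) :
    skewInfo f ρ H = f 0 / 2 * metricForm f ρ.posSemidef.isHermitian (liouvillian H ρ.mat) := by
  rw [skewInfo, quantumFisherInfo, stateDeriv_evolve, evolve_zero,
    re_trace_mul_mcSuperop f ρ (isHermitian_liouvillian H ρ.posSemidef.isHermitian)]

theorem skewInfo_nonneg {f : ℝ → ℝ} (hf : IsStandardMonotone f) (ρ : State d)
    (H : Hamiltonian d) : 0 ≤ skewInfo f ρ H := by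
  rw [skewInfo_eq]
  refine mul_nonneg (by linarith [hf.zero_nonneg]) (Finset.sum_nonneg fun i _ =>
    Finset.sum_nonneg fun j _ => mul_nonneg (inv_nonneg.2 (hf.scalarMean_nonneg ?_ ?_))
      (by positivity))
  exacts [ρ.posSemidef.eigenvalues_nonneg i, ρ.posSemidef.eigenvalues_nonneg j]

theorem IsSymmetric.skewInfo_eq_zero (f : ℝ → ℝ) {ρ : State d} {H : Hamiltonian d}
    (h : IsSymmetric ρ H) : skewInfo f ρ H = 0 := by
  have h1 : stateDeriv (fun t => ρ.evolve H t) 0 = 0 := by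
    ext i j
    simp only [stateDeriv, of_apply, ← h _, deriv_const, Matrix.zero_apply]
  rw [skewInfo, quantumFisherInfo, h1]
  simp

theorem IsSymmetric.smoothSkewInfo_eq_zero {f : ℝ → ℝ} (hf : IsStandardMonotone f) {ρ : State d}
    {H : Hamiltonian d} (h : IsSymmetric ρ H) {ε : ℝ} (hε : 0 ≤ ε) :
    smoothSkewInfo f ε ρ H = 0 := by
  refine le_antisymm ?_ (le_iInf₂ fun σ _ => by exact_mod_cast skewInfo_nonneg hf σ H)
  refine (iInf₂_le ρ (by rwa [traceDist_self])).trans ?_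
  rw [h.skewInfo_eq_zero f]
  simp

end TimeEvolution

/-! ### Monotonicity under covariant channels, exact and smoothed. -/

section CovariantChannels

variable {d : Type*} {d' : Type*} [Fintype d] [DecidableEq d] [Fintype d'] [DecidableEq d']

/-- The image of a state under a channel. -/
def IsChannel.mapState {E : Matrix d d ℂ →ₗ[ℂ] Matrix d' d' ℂ} (hE : IsChannel E) (ρ : State d) :
    State d' where
  mat := E ρ.mat
  posSemidef := hE.map_posSemidef ρ.posSemidef
  trace_eq_one := by rw [hE.trace_preserving, ρ.trace_eq_one]

namespace IsCovariantChannel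

variable {H : Hamiltonian d} {H' : Hamiltonian d'} {E : Matrix d d ℂ →ₗ[ℂ] Matrix d' d' ℂ}
  (hE : IsCovariantChannel H H' E)
include hE

/-- Both sides are the derivative at `t = 0` of the covariance identity. -/
theorem map_liouvillian (ρ : State d) :
    E (liouvillian H ρ.mat) = liouvillian H' (E ρ.mat) := by
  have key : ∀ Z, E Z = ∑ i, ∑ j, Z i j • E (single i j 1) := fun Z => by
    conv_lhs => rw [matrix_eq_sum_single Z]
    simp only [map_sum]
    refine Finset.sum_congr rfl fun i _ => Finset.sum_congr rfl fun j _ => ?_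
    rw [← map_smul, smul_single, smul_eq_mul, mul_one]
  ext i' j'
  have h1 : HasDerivAt (fun t => E (conjEvolve H t ρ.mat) i' j')
      (E (liouvillian H ρ.mat) i' j') 0 := by
    simp only [key (conjEvolve _ _ _), key (liouvillian _ _), Matrix.sum_apply, Matrix.smul_apply,
      smul_eq_mul]
    exact HasDerivAt.fun_sum fun i _ => HasDerivAt.fun_sum fun j _ =>
      (hasDerivAt_conjEvolve H ρ.mat i j).mul_const _
  have h2 := hasDerivAt_conjEvolve H' (E ρ.mat) i' j'
  simp only [hE.covariant ρ] at h1
  exact h1.unique h2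

/-- The metric adjusted skew information decreases under covariant channels. -/
theorem skewInfo_mapState_le {f : ℝ → ℝ} (hf : IsStandardMonotone f) (hreg : IsRegularAtZero f)
    (ρ : State d) : skewInfo f (hE.isChannel.mapState ρ) H' ≤ skewInfo f ρ H := by
  rw [skewInfo_eq, skewInfo_eq]
  refine mul_le_mul_of_nonneg_left ?_ (by linarith [hf.zero_nonneg])
  have h := hE.isChannel.metricForm_le hf ρ.posSemidef (hE.isChannel.mapState ρ).posSemidef
    (D := liouvillian H ρ.mat) fun i j hij => by
      obtain ⟨h1, h2⟩ := hf.eq_zero_of_scalarMean_eq_zero hreg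
        (ρ.posSemidef.eigenvalues_nonneg i) (ρ.posSemidef.eigenvalues_nonneg j) hij
      exact eigenbasisMatrix_liouvillian_eq_zero H _ (h1.trans h2.symm)
  rwa [hE.map_liouvillian] at h

/-- Each competitor `τ` for `ρ` yields the competitor `E τ` for `σ`, whose distance from `σ` is
controlled by passing through `E ρ`. -/
theorem smoothSkewInfo_le {f : ℝ → ℝ} (hf : IsStandardMonotone f) (hreg : IsRegularAtZero f)
    {ρ : State d} {σ : State d'} {δ ε : ℝ} (h : traceDist (E ρ.mat) σ.mat ≤ ε) :
    smoothSkewInfo f (δ + ε) σ H' ≤ smoothSkewInfo f δ ρ H := by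
  refine le_iInf₂ fun τ hτ => (iInf₂_le (hE.isChannel.mapState τ) ?_).trans
    (EReal.coe_le_coe_iff.2 (hE.skewInfo_mapState_le hf hreg τ))
  have hEρ := (hE.isChannel.map_posSemidef ρ.posSemidef).isHermitian
  have hEτ := (hE.isChannel.map_posSemidef τ.posSemidef).isHermitian
  have h1 := traceDist_triangle σ.posSemidef.isHermitian hEρ hEτ
  have h2 := hE.isChannel.traceDist_map_le ρ.posSemidef.isHermitian τ.posSemidef.isHermitian
  rw [traceDist_comm σ.posSemidef.isHermitian hEρ] at h1
  change traceDist σ.mat (E τ.mat) ≤ δ + ε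
  linarith

end IsCovariantChannel

end CovariantChannels

/-! ### Passage to the rates. -/

section Rates

variable {d : ℕ → Type u} [∀ m, Fintype (d m)] [∀ m, DecidableEq (d m)]
  {d' : ℕ → Type v} [∀ m, Fintype (d' m)] [∀ m, DecidableEq (d' m)]
  {f : ℝ → ℝ} {ρ : ∀ m, State (d m)} {H : ∀ m, Hamiltonian (d m)}
  {σ : ∀ m, State (d' m)} {H' : ∀ m, Hamiltonian (d' m)}

theorem AsympConvertible.eventually_smoothSkewInfo_le (h : AsympConvertible ρ H σ H')
    (hf : IsStandardMonotone f) (hreg : IsRegularAtZero f) {ε : ℝ} (hε : 0 < ε) :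
    ∀ᶠ m : ℕ in atTop, ((1 / (m : ℝ) : ℝ) : EReal) * smoothSkewInfo f ε (σ m) (H' m) ≤
      ((1 / (m : ℝ) : ℝ) : EReal) * smoothSkewInfo f (ε / 2) (ρ m) (H m) := by
  -- The accuracy is at most `ε / 4`, strictly below `ε / 2`, so the bound on the limsup gives
  -- distance below `ε / 2` eventually; the minimum with `1` keeps it in the permitted range.
  obtain ⟨E, hE, hlim⟩ := h (min 1 (ε / 4)) (by positivity) (min_le_left _ _)
  have hlt : ((min 1 (ε / 4) : ℝ) : EReal) < ((ε / 2 : ℝ) : EReal) :=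
    EReal.coe_lt_coe_iff.2 ((min_le_right _ _).trans_lt (by linarith))
  filter_upwards [eventually_lt_of_limsup_lt (hlim.trans_lt hlt)] with m hm
  have h1 := (hE m).smoothSkewInfo_le hf hreg (δ := ε / 2) (EReal.coe_lt_coe_iff.1 hm).le
  rw [add_halves] at h1
  exact mul_le_mul_of_nonneg_left h1 (by exact_mod_cast (by positivity : (0 : ℝ) ≤ 1 / m))

theorem tendsto_half_nhdsGT_zero : Tendsto (fun ε : ℝ => ε / 2) (𝓝[>] 0) (𝓝[>] 0) := by
  refine tendsto_nhdsWithin_iff.2 ⟨?_, ?_⟩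
  · have : Continuous fun ε : ℝ => ε / 2 := by fun_prop
    simpa using (this.tendsto 0).mono_left nhdsWithin_le_nhds
  · filter_upwards [eventually_mem_nhdsWithin] with ε hε
    exact half_pos (Set.mem_Ioi.1 hε)

theorem AsympConvertible.supRate_le (h : AsympConvertible ρ H σ H')
    (hf : IsStandardMonotone f) (hreg : IsRegularAtZero f) : supRate f σ H' ≤ supRate f ρ H := by
  refine le_of_tendsto_of_tendsto (tendsto_supRate f σ H')
    ((tendsto_supRate f ρ H).comp tendsto_half_nhdsGT_zero) ?_
  filter_upwards [eventually_mem_nhdsWithin] with ε hε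
  exact limsup_le_limsup (h.eventually_smoothSkewInfo_le hf hreg hε)

theorem AsympConvertible.infRate_le (h : AsympConvertible ρ H σ H')
    (hf : IsStandardMonotone f) (hreg : IsRegularAtZero f) : infRate f σ H' ≤ infRate f ρ H := by
  refine le_of_tendsto_of_tendsto (tendsto_infRate f σ H')
    ((tendsto_infRate f ρ H).comp tendsto_half_nhdsGT_zero) ?_
  filter_upwards [eventually_mem_nhdsWithin] with ε hε
  exact liminf_le_liminf (h.eventually_smoothSkewInfo_le hf hreg hε)

theorem supRate_eq_zero (hf : IsStandardMonotone f) (h : ∀ m, IsSymmetric (ρ m) (H m)) :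
    supRate f ρ H = 0 := by
  refine tendsto_nhds_unique (tendsto_supRate f ρ H) (tendsto_const_nhds.congr' ?_)
  filter_upwards [eventually_mem_nhdsWithin] with ε hε
  simp [smoothLimsup, (h _).smoothSkewInfo_eq_zero hf (le_of_lt hε)]

theorem infRate_eq_zero (hf : IsStandardMonotone f) (h : ∀ m, IsSymmetric (ρ m) (H m)) :
    infRate f ρ H = 0 := by
  refine tendsto_nhds_unique (tendsto_infRate f ρ H) (tendsto_const_nhds.congr' ?_)
  filter_upwards [eventually_mem_nhdsWithin] with ε hε
  simp [smoothLiminf, (h _).smoothSkewInfo_eq_zero hf (le_of_lt hε)]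

end Rates

end SmoothSkew

theorem theorem1 (f : ℝ → ℝ) (hf : SmoothSkew.IsStandardMonotone f)
    (hreg : SmoothSkew.IsRegularAtZero f) :
    (∀ (d : ℕ → Type u) [∀ m, Fintype (d m)] [∀ m, DecidableEq (d m)]
        (d' : ℕ → Type v) [∀ m, Fintype (d' m)] [∀ m, DecidableEq (d' m)]
        (ρ : ∀ m, SmoothSkew.State (d m)) (H : ∀ m, SmoothSkew.Hamiltonian (d m))
        (σ : ∀ m, SmoothSkew.State (d' m)) (H' : ∀ m, SmoothSkew.Hamiltonian (d' m)),
        SmoothSkew.AsympConvertible ρ H σ H' →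
          SmoothSkew.supRate f σ H' ≤ SmoothSkew.supRate f ρ H ∧
          SmoothSkew.infRate f σ H' ≤ SmoothSkew.infRate f ρ H) ∧
    (∀ (d : ℕ → Type u) [∀ m, Fintype (d m)] [∀ m, DecidableEq (d m)]
        (ρ : ∀ m, SmoothSkew.State (d m)) (H : ∀ m, SmoothSkew.Hamiltonian (d m)),
        (∀ m, SmoothSkew.IsSymmetric (ρ m) (H m)) →
          SmoothSkew.supRate f ρ H = 0 ∧ SmoothSkew.infRate f ρ H = 0) :=
  ⟨fun _ _ _ _ _ _ _ _ _ _ h => ⟨h.supRate_le hf hreg, h.infRate_le hf hreg⟩,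
    fun _ _ _ _ _ h => ⟨SmoothSkew.supRate_eq_zero hf h, SmoothSkew.infRate_eq_zero hf h⟩⟩
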